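/- Let $n\ge 2$, and let $\mathcal T_n$ be the cluster complex of type $A_n$: the simplicial complex on the diagonals of an $(n+3)$-gon $P$ with vertices $1,\dots,n+3$ in cyclic order, whose simplices are the nonempty sets of pairwise noncrossing diagonals, so that its maximal simplices are the triangulations of $P$. Call two simplices near if they have $n-1$ diagonals in common (share an $(n-2)$-face). A chain is a finite sequence of simplices in which consecutive ones are near; a loop based at a triangulation $T_0$ is a chain that starts and ends at $T_0$. Discrete homotopy is the equivalence relation on chains with fixed end points generated by (i) repeating a simplex of the chain and (ii) replacing a chain by one of the same length and with the same end points such that simplices in equal positions are near. The discrete fundamental group $A_1^{n-2}(\mathcal T_n,T_0)$ is the group of discrete homotopy classes of loops based at $T_0$ under concatenation, and $A_1^{n-2}(\mathcal T_n)^{ab}$ denotes its abelianization. A geodesic 5-cycle is a 5-cycle of distinct triangulations, cyclically consecutive ones being near, all of which contain a fixed set of $n-2$ pairwise noncrossing diagonals. That set of diagonals dissects $P$ into triangles and exactly one pentagon, and the label of the 5-cycle is the 5-element set of vertices of this pentagon. The class of a geodesic 5-cycle, traversed from a chosen starting node in a chosen direction, is the class in $A_1^{n-2}(\mathcal T_n)^{ab}$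 of a loop that runs from $T_0$ along a chain to the starting node, once around the cycle, and back along the same chain. Theorem. For every triangulation $T_0$ the group $A_1^{n-2}(\mathcal T_n)^{ab}$ is free abelian. Every geodesic 5-cycle has exactly one label, and its class exists and does not depend on the connecting chain. Every 5-element set of vertices of $P$ is the label of a geodesic 5-cycle, and two geodesic 5-cycles with the same label have classes that are equal up to sign. If for each of the 5-element sets of vertices containing the vertex $1$ one chooses the class of a geodesic 5-cycle with this label (in either direction), then the chosen classes form a $\mathbb Z$-basis of $A_1^{n-2}(\mathcal T_n)^{ab}$ with $\binom{n+2}{4}$ elements; they are a minimal generating set (no proper subset generates), and no generating set of the group has fewer than $\binom{n+2}{4}$ elements. -/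

import Mathlib

/-! ### Discrete homotopy theory of an abstract simplicial complex -/

/-- The simplices of an abstract simplicial complex. -/
abbrev Simplex {ι : Type*} (Δ : AbstractSimplicialComplex ι) : Type _ :=
  {s : Finset ι // s ∈ Δ.faces}

/-- A simplex is maximal if it is not properly contained in another simplex. -/
def IsMaximalSimplex {ι : Type*} {Δ : AbstractSimplicialComplex ι} (σ : Simplex Δ) : Prop :=
  ∀ τ : Simplex Δ, σ.1 ⊆ τ.1 → τ = σ

/-- Two simplices are `q`-near if they share a `q`-face, that is, a face with `q + 1` vertices. -/
def QNear {ι : Type*} {Δ : AbstractSimplicialComplex ι} (q : ℕ) (σ τ : Simplex Δ) : Prop :=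
  ∃ ρ : Simplex Δ, ρ.1.card = q + 1 ∧ ρ.1 ⊆ σ.1 ∧ ρ.1 ⊆ τ.1

theorem QNear.symm {ι : Type*} {Δ : AbstractSimplicialComplex ι} {q : ℕ} {σ τ : Simplex Δ}
    (h : QNear q σ τ) : QNear q τ σ :=
  let ⟨ρ, hc, h₁, h₂⟩ := h
  ⟨ρ, hc, h₂, h₁⟩

theorem QNear.left {ι : Type*} {Δ : AbstractSimplicialComplex ι} {q : ℕ} {σ τ : Simplex Δ}
    (h : QNear q σ τ) : QNear q σ σ :=
  let ⟨ρ, hc, h₁, _⟩ := h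
  ⟨ρ, hc, h₁, h₁⟩

/-- A `q`-chain `σ = σ₀ - σ₁ - ⋯ - σₖ = τ`: consecutive simplices are `q`-near (they may be
equal). -/
inductive QChain {ι : Type*} (Δ : AbstractSimplicialComplex ι) (q : ℕ) :
    Simplex Δ → Simplex Δ → Type _
  | nil (σ : Simplex Δ) : QChain Δ q σ σ
  | cons {σ τ υ : Simplex Δ} (h : QNear q σ τ) (p : QChain Δ q τ υ) : QChain Δ q σ υ

namespace QChain

variable {ι : Type*} {Δ : AbstractSimplicialComplex ι} {q : ℕ}

/-- Concatenation of chains. -/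
def append {σ τ υ : Simplex Δ} : QChain Δ q σ τ → QChain Δ q τ υ → QChain Δ q σ υ
  | nil _, r => r
  | cons h p, r => cons h (append p r)

/-- The chain read in reverse order. -/
def reverse {σ τ : Simplex Δ} : QChain Δ q σ τ → QChain Δ q τ σ
  | nil σ => nil σ
  | cons h p => append (reverse p) (cons h.symm (nil _))

/-- `Stretch p p'`: the chain `p'` arises from `p` by repeating one simplex,
`⋯ - σᵢ - ⋯` becoming `⋯ - σᵢ - σᵢ - ⋯`. -/
inductive Stretch : {σ τ : Simplex Δ} → QChain Δ q σ τ → QChain Δ q σ τ → Prop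
  | here {σ τ : Simplex Δ} (h : QNear q σ σ) (p : QChain Δ q σ τ) : Stretch p (cons h p)
  | there {σ τ υ : Simplex Δ} (h : QNear q σ τ) {p p' : QChain Δ q τ υ} :
      Stretch p p' → Stretch (cons h p) (cons h p')

/-- `RowNear p p'`: the chains `p` and `p'` have the same length, and simplices in the same position
are `q`-near. Two loops related in this way form two consecutive rows of a grid. -/
inductive RowNear : {σ τ σ' τ' : Simplex Δ} → QChain Δ q σ τ → QChain Δ q σ' τ' → Prop
  | nil {σ σ' : Simplex Δ} (v : QNear q σ σ') : RowNear (nil σ) (nil σ')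
  | cons {σ τ υ σ' τ' υ' : Simplex Δ} (h : QNear q σ τ) (h' : QNear q σ' τ')
      {p : QChain Δ q τ υ} {p' : QChain Δ q τ' υ'} (v : QNear q σ σ') :
      RowNear p p' → RowNear (cons h p) (cons h' p')

/-- Discrete homotopy of `q`-chains with fixed end points (in particular of `q`-loops with a fixed
base simplex): the equivalence relation generated by repetition of a simplex and by grids. A grid
is a finite sequence of chains with the given end points in which consecutive chains are
`RowNear`; so it suffices to take grids with two rows as generators. -/
def Homotopic {σ τ : Simplex Δ} (p p' : QChain Δ q σ τ) : Prop :=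
  Relation.EqvGen (fun r r' : QChain Δ q σ τ => Stretch r r' ∨ RowNear r r') p p'

theorem append_nil {σ τ : Simplex Δ} (p : QChain Δ q σ τ) : append p (nil τ) = p := by
  induction p with
  | nil => rfl
  | cons h p ih => simp [append, ih]

theorem append_assoc {σ τ υ ω : Simplex Δ} (p : QChain Δ q σ τ) (r : QChain Δ q τ υ)
    (s : QChain Δ q υ ω) : append (append p r) s = append p (append r s) := by
  induction p with
  | nil => rfl
  | cons h p ih => simp [append, ih]

theorem Stretch.append_right {σ τ υ : Simplex Δ} {p p' : QChain Δ q σ τ} (h : Stretch p p')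
    (r : QChain Δ q τ υ) : Stretch (append p r) (append p' r) := by
  induction h with
  | here h p => exact .here h _
  | there h _ ih => exact .there h (ih r)

theorem Stretch.append_left {σ τ υ : Simplex Δ} (p : QChain Δ q σ τ) {r r' : QChain Δ q τ υ}
    (h : Stretch r r') : Stretch (append p r) (append p r') := by
  induction p with
  | nil => exact h
  | cons k p ih => exact .there k (ih h)

theorem Stretch.append_self {σ τ : Simplex Δ} (p : QChain Δ q σ τ) (h : QNear q τ τ) :
    Stretch p (append p (cons h (nil τ))) := by
  induction p with
  | nil => exact .here h _
  | cons k p ih => exact .there k (ih h)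

theorem Stretch.reverse {σ τ : Simplex Δ} {p p' : QChain Δ q σ τ} (h : Stretch p p') :
    Stretch p.reverse p'.reverse := by
  induction h with
  | here h p => exact .append_self _ _
  | there h _ ih => exact ih.append_right _

theorem RowNear.refl {σ τ : Simplex Δ} (p : QChain Δ q σ τ) (h : QNear q σ σ) : RowNear p p := by
  induction p with
  | nil => exact .nil h
  | cons k p ih => exact .cons k k h (ih k.symm.left)

theorem RowNear.append {σ τ υ σ' τ' υ' : Simplex Δ} {p : QChain Δ q σ τ} {p' : QChain Δ q σ' τ'}
    (h : RowNear p p') {r : QChain Δ q τ υ} {r' : QChain Δ q τ' υ'} (k : RowNear r r') :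
    RowNear (append p r) (append p' r') := by
  induction h with
  | nil v => exact k
  | cons h h' v _ ih => exact .cons h h' v (ih k)

theorem RowNear.left_end {σ τ σ' τ' : Simplex Δ} {p : QChain Δ q σ τ} {p' : QChain Δ q σ' τ'}
    (h : RowNear p p') : QNear q τ τ' := by
  induction h with
  | nil v => exact v
  | cons h h' v _ ih => exact ih

theorem RowNear.left_start {σ τ σ' τ' : Simplex Δ} {p : QChain Δ q σ τ} {p' : QChain Δ q σ' τ'}
    (h : RowNear p p') : QNear q σ σ' := by
  cases h with
  | nil v => exact v
  | cons h h' v _ => exact v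

theorem RowNear.reverse {σ τ σ' τ' : Simplex Δ} {p : QChain Δ q σ τ} {p' : QChain Δ q σ' τ'}
    (h : RowNear p p') : RowNear p.reverse p'.reverse := by
  induction h with
  | nil v => exact .nil v
  | cons h h' v k ih => exact ih.append (.cons _ _ k.left_start (.nil v))

theorem Homotopic.append_right {σ τ υ : Simplex Δ} {p p' : QChain Δ q σ τ} (h : Homotopic p p')
    (r : QChain Δ q τ υ) : Homotopic (append p r) (append p' r) := by
  induction h with
  | rel p p' h =>
    rcases h with h | h
    · exact .rel _ _ (.inl (h.append_right r))
    · exact .rel _ _ (.inr (h.append (.refl r h.left_end)))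
  | refl p => exact .refl _
  | symm p p' _ ih => exact .symm _ _ ih
  | trans p p' p'' _ _ ih ih' => exact .trans _ _ _ ih ih'

theorem Homotopic.append_left {σ τ υ : Simplex Δ} (p : QChain Δ q σ τ) {r r' : QChain Δ q τ υ}
    (h : Homotopic r r') : Homotopic (append p r) (append p r') := by
  induction h with
  | rel r r' h =>
    rcases h with h | h
    · exact .rel _ _ (.inl (h.append_left p))
    · refine .rel _ _ (.inr (RowNear.append ?_ h))
      cases p with
      | nil => exact .nil h.left_start
      | cons k p => exact .refl _ k.left
  | refl p => exact .refl _
  | symm p p' _ ih => exact .symm _ _ ih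
  | trans p p' p'' _ _ ih ih' => exact .trans _ _ _ ih ih'

theorem Homotopic.reverse {σ τ : Simplex Δ} {p p' : QChain Δ q σ τ} (h : Homotopic p p') :
    Homotopic p.reverse p'.reverse := by
  induction h with
  | rel p p' h =>
    rcases h with h | h
    · exact .rel _ _ (.inl h.reverse)
    · exact .rel _ _ (.inr h.reverse)
  | refl p => exact .refl _
  | symm p p' _ ih => exact .symm _ _ ih
  | trans p p' p'' _ _ ih ih' => exact .trans _ _ _ ih ih'

theorem Homotopic.backtrack {σ τ υ : Simplex Δ} (h : QNear q τ σ) (h' : QNear q σ τ)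
    (p : QChain Δ q τ υ) : Homotopic (cons h (cons h' p)) p := by
  have v : QNear q τ τ := h.left
  refine .trans _ (cons v (cons v p)) _
    (.rel _ _ (.inr (.cons _ _ v (.cons _ _ h' (.refl p v))))) ?_
  exact .symm _ _ (.trans _ (cons v p) _ (.rel _ _ (.inl (.here v p)))
    (.rel _ _ (.inl (.here v _))))

theorem Homotopic.reverse_append {σ τ : Simplex Δ} (p : QChain Δ q σ τ) :
    Homotopic (append p.reverse p) (nil τ) := by
  induction p with
  | nil => exact .refl _
  | cons h p ih =>
    refine .trans _ _ _ ?_ ih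
    rw [QChain.reverse, append_assoc]
    exact Homotopic.append_left _ (.backtrack _ _ p)

/-- Discrete homotopy as a setoid on the `q`-loops with base simplex `σ₀`. -/
def loopSetoid (Δ : AbstractSimplicialComplex ι) (q : ℕ) (σ₀ : Simplex Δ) :
    Setoid (QChain Δ q σ₀ σ₀) where
  r := Homotopic
  iseqv := ⟨fun p => .refl p, fun h => .symm _ _ h, fun h h' => .trans _ _ _ h h'⟩

end QChain

/-- The discrete fundamental group `A₁^q(Δ, σ₀)`: discrete homotopy classes of `q`-loops based at
`σ₀`. -/
def DiscreteFundamentalGroup {ι : Type*} (Δ : AbstractSimplicialComplex ι) (q : ℕ)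
    (σ₀ : Simplex Δ) : Type _ :=
  Quotient (QChain.loopSetoid Δ q σ₀)

/-- Multiplication is concatenation of loops, the identity is the class of the constant loop, and
inversion is reversal of loops. -/
instance {ι : Type*} (Δ : AbstractSimplicialComplex ι) (q : ℕ) (σ₀ : Simplex Δ) :
    Group (DiscreteFundamentalGroup Δ q σ₀) where
  mul := Quotient.map₂ QChain.append fun _ _ h _ _ h' =>
    .trans _ _ _ (h.append_right _) (QChain.Homotopic.append_left _ h')
  one := Quotient.mk _ (QChain.nil σ₀)
  inv := Quotient.map QChain.reverse fun _ _ h => h.reverse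
  mul_assoc a b c := Quotient.inductionOn₃ a b c fun p r s =>
    congrArg (Quotient.mk _) (QChain.append_assoc p r s)
  one_mul a := Quotient.inductionOn a fun _ => rfl
  mul_one a := Quotient.inductionOn a fun p => congrArg (Quotient.mk _) (QChain.append_nil p)
  inv_mul_cancel a := Quotient.inductionOn a fun p =>
    Quotient.sound (QChain.Homotopic.reverse_append p)

/-- The class of a loop in the abelianization `A₁^q(Δ, σ₀)^ab`, written additively. -/
def loopClassAb {ι : Type*} {Δ : AbstractSimplicialComplex ι} {q : ℕ} {σ₀ : Simplex Δ}
    (p : QChain Δ q σ₀ σ₀) : Additive (Abelianization (DiscreteFundamentalGroup Δ q σ₀)) :=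
  Additive.ofMul (Abelianization.of (Quotient.mk (QChain.loopSetoid Δ q σ₀) p))

/-! ### The cluster complex of type `A_n` -/

/-- The diagonals of the `(n + 3)`-gon, whose vertices in cyclic order are `0, 1, …, n + 2`: pairs
`i < j` of vertices that are not adjacent on the boundary. -/
abbrev Diagonal (n : ℕ) : Type :=
  {d : Fin (n + 3) × Fin (n + 3) //
    d.1.val + 1 < d.2.val ∧ ¬ (d.1.val = 0 ∧ d.2.val = n + 2)}

/-- Two diagonals cross if they meet in an interior point of the polygon, that is, if their end
points are four distinct alternating vertices. -/
def Crosses {n : ℕ} (d e : Diagonal n) : Prop :=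
  (d.1.1 < e.1.1 ∧ e.1.1 < d.1.2 ∧ d.1.2 < e.1.2) ∨
    (e.1.1 < d.1.1 ∧ d.1.1 < e.1.2 ∧ e.1.2 < d.1.2)

/-- The cluster complex `𝒯_n` of type `A_n`: its simplices are the nonempty sets of pairwise
noncrossing diagonals of the `(n + 3)`-gon, so that its maximal simplices are the
triangulations. -/
def clusterComplex (n : ℕ) : AbstractSimplicialComplex (Diagonal n) where
  faces := {s | s.Nonempty ∧ ∀ d ∈ s, ∀ e ∈ s, ¬ Crosses d e}
  isRelLowerSet_faces := fun _ hs =>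
    ⟨hs.1, fun _ hts ht => ⟨ht, fun d hd e he => hs.2 d (hts hd) e (hts he)⟩⟩
  singleton_mem := fun d => by
    refine ⟨Finset.singleton_nonempty d, fun e he f hf => ?_⟩
    rw [Finset.mem_singleton] at he hf
    subst he hf
    rintro (⟨h, -, -⟩ | ⟨h, -, -⟩) <;> exact lt_irrefl _ h

/-- The discrete fundamental group `A₁^{n-2}(𝒯_n, T₀)`, abelianized and written additively. -/
abbrev ClusterGroupAb (n : ℕ) (T₀ : Simplex (clusterComplex n)) : Type :=
  Additive (Abelianization (DiscreteFundamentalGroup (clusterComplex n) (n - 2) T₀))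

/-- The segment between the vertices `i < j` is a boundary edge of the polygon or belongs to `S`. -/
def IsEdgeOf {n : ℕ} (S : Finset (Diagonal n)) (i j : Fin (n + 3)) : Prop :=
  i.val + 1 = j.val ∨ (i.val = 0 ∧ j.val = n + 2) ∨ ∃ d ∈ S, d.1 = (i, j)

/-- For a set `S` of pairwise noncrossing diagonals: `L` is the vertex set of a pentagonal region of
the dissection of the polygon by `S`, i.e. the five sides of the pentagon are boundary edges or
members of `S`, and none of its five diagonals is in `S`. -/
def IsPentagonRegion {n : ℕ} (S : Finset (Diagonal n)) (L : Finset (Fin (n + 3))) : Prop :=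
  ∃ a b c d e : Fin (n + 3), a < b ∧ b < c ∧ c < d ∧ d < e ∧ L = {a, b, c, d, e} ∧
    (IsEdgeOf S a b ∧ IsEdgeOf S b c ∧ IsEdgeOf S c d ∧ IsEdgeOf S d e ∧ IsEdgeOf S a e) ∧
    (¬ IsEdgeOf S a c ∧ ¬ IsEdgeOf S b d ∧ ¬ IsEdgeOf S c e ∧ ¬ IsEdgeOf S a d ∧ ¬ IsEdgeOf S b e)

/-- A geodesic 5-cycle: a 5-cycle `node 0 - node 1 - ⋯ - node 4 - node 0` of distinct triangulations,
consecutive ones being `(n - 2)`-near, all containing a fixed simplex `core` of codimension 2, i.e. a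
set of `n - 2` diagonals (empty if `n = 2`). As a function it comes with a starting point and a
direction. -/
structure GeodesicFiveCycle (n : ℕ) where
  core : Finset (Diagonal n)
  card_core : core.card + 2 = n
  node : Fin 5 → Simplex (clusterComplex n)
  node_injective : Function.Injective node
  isMaximal_node : ∀ i, IsMaximalSimplex (node i)
  core_subset : ∀ i, core ⊆ (node i).1
  near : ∀ i, QNear (n - 2) (node i) (node (i + 1))

namespace GeodesicFiveCycle

variable {n : ℕ}

/-- `L` is the label of `C`: the vertex set of the pentagon left untriangulated by the core. -/
def HasLabel (C : GeodesicFiveCycle n) (L : Finset (Fin (n + 3))) : Prop :=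
  IsPentagonRegion C.core L

/-- The loop that goes once around the cycle, starting at `node 0`. -/
def loop (C : GeodesicFiveCycle n) :
    QChain (clusterComplex n) (n - 2) (C.node 0) (C.node 0) :=
  .cons (C.near 0) (.cons (C.near 1) (.cons (C.near 2) (.cons (C.near 3) (.cons (C.near 4)
    (.nil _)))))

/-- The class in `A₁^{n-2}(𝒯_n, T₀)^ab` of the based loop that runs along `p` from `T₀` to the cycle,
once around the cycle, and back along `p`. -/
def classVia {T₀ : Simplex (clusterComplex n)} (C : GeodesicFiveCycle n)
    (p : QChain (clusterComplex n) (n - 2) T₀ (C.node 0)) : ClusterGroupAb n T₀ :=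
  loopClassAb ((p.append C.loop).append p.reverse)

end GeodesicFiveCycle

/-- `x` is the homotopy class, in `A₁^{n-2}(𝒯_n, T₀)^ab`, of a geodesic 5-cycle with label `L`. -/
def IsFiveCycleClass {n : ℕ} (T₀ : Simplex (clusterComplex n)) (L : Finset (Fin (n + 3)))
    (x : ClusterGroupAb n T₀) : Prop :=
  ∃ C : GeodesicFiveCycle n, C.HasLabel L ∧
    ∃ p : QChain (clusterComplex n) (n - 2) T₀ (C.node 0), C.classVia p = x

/-- The possible labels that contain the first vertex of the polygon (the vertex numbered `0`
here). -/
abbrev LabelAtFirst (n : ℕ) : Type :=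
  {L : Finset (Fin (n + 3)) // L.card = 5 ∧ (0 : Fin (n + 3)) ∈ L}

/-! ### Triangulations, their triangles and their flips. -/

/-- A triangulation of the `(n + 3)`-gon: a maximal simplex of the cluster complex. -/
abbrev Tri (n : ℕ) : Type := {T : Simplex (clusterComplex n) // IsMaximalSimplex T}

/-- The segment from `i` to `j` is a side of the polygon or belongs to `S`. -/
def Edge {n : ℕ} (S : Finset (Diagonal n)) (i j : ℕ) : Prop :=
  i < j ∧ j ≤ n + 2 ∧
    (j = i + 1 ∨ (i = 0 ∧ j = n + 2) ∨ ∃ d ∈ S, d.1.1.val = i ∧ d.1.2.val = j)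

/-- The diagonal with given end points. -/
def mkDiagonal {n : ℕ} (i j : ℕ) (h : i + 1 < j) (h' : j ≤ n + 2) (h0 : ¬ (i = 0 ∧ j = n + 2)) :
    Diagonal n :=
  ⟨(⟨i, by omega⟩, ⟨j, by omega⟩), h, h0⟩

section Basic

variable {n : ℕ}

theorem Diagonal.ext_val {d e : Diagonal n} (h₁ : d.1.1.val = e.1.1.val)
    (h₂ : d.1.2.val = e.1.2.val) : d = e :=
  Subtype.ext (Prod.ext (Fin.ext h₁) (Fin.ext h₂))

theorem Edge.of_mem {S : Finset (Diagonal n)} {d : Diagonal n} (h : d ∈ S) :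
    Edge S d.1.1.val d.1.2.val :=
  ⟨by have := d.2.1; omega, by have := d.1.2.isLt; omega, .inr (.inr ⟨d, h, rfl, rfl⟩)⟩

theorem Edge.mem {S : Finset (Diagonal n)} {d : Diagonal n} (h : Edge S d.1.1.val d.1.2.val) :
    d ∈ S := by
  obtain ⟨-, -, h | h | ⟨e, he, h₁, h₂⟩⟩ := h
  · have := d.2.1; omega
  · exact absurd h d.2.2
  · rwa [← Diagonal.ext_val h₁ h₂]

theorem Edge.mono {S S' : Finset (Diagonal n)} (h : S ⊆ S') {i j : ℕ} (e : Edge S i j) :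
    Edge S' i j :=
  ⟨e.1, e.2.1, e.2.2.imp_right (Or.imp_right fun ⟨d, hd, h'⟩ => ⟨d, h hd, h'⟩)⟩

theorem isEdgeOf_iff {S : Finset (Diagonal n)} {i j : Fin (n + 3)} (hij : i < j) :
    IsEdgeOf S i j ↔ Edge S i.val j.val := by
  have h1 : i.val < j.val := hij
  have h2 : j.val ≤ n + 2 := by omega
  simp only [IsEdgeOf, Edge, h1, h2, true_and, eq_comm (a := j.val)]
  refine or_congr_right (or_congr_right (exists_congr fun d => and_congr_right fun _ => ?_))
  rw [Prod.ext_iff, Fin.ext_iff, Fin.ext_iff]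

theorem crosses_iff {d e : Diagonal n} : Crosses d e ↔
    (d.1.1.val < e.1.1.val ∧ e.1.1.val < d.1.2.val ∧ d.1.2.val < e.1.2.val) ∨
      (e.1.1.val < d.1.1.val ∧ d.1.1.val < e.1.2.val ∧ e.1.2.val < d.1.2.val) := Iff.rfl

/-- Edges of a noncrossing set of diagonals do not cross. -/
theorem Edge.noncross {S : Finset (Diagonal n)} (hS : ∀ d ∈ S, ∀ e ∈ S, ¬ Crosses d e)
    {i j k l : ℕ} (h : Edge S i j) (h' : Edge S k l) : ¬ (i < k ∧ k < j ∧ j < l) := by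
  obtain ⟨h1, h2, h | h | ⟨d, hd, rfl, rfl⟩⟩ := h
  · omega
  · have := h'.2.1; omega
  obtain ⟨h1', h2', h' | h' | ⟨e, he, rfl, rfl⟩⟩ := h'
  · omega
  · omega
  · exact fun hc => hS d hd e he (.inl hc)

namespace Tri

/-- Edges of a triangulation. -/
abbrev E (T : Tri n) (i j : ℕ) : Prop := Edge T.1.1 i j

theorem nc (T : Tri n) {i j k l : ℕ} (h : T.E i j) (h' : T.E k l) : ¬ (i < k ∧ k < j ∧ j < l) :=
  Edge.noncross T.1.2.2 h h'

theorem mem_of_noncross (T : Tri n) (d : Diagonal n) (h : ∀ e ∈ T.1.1, ¬ Crosses d e) :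
    d ∈ T.1.1 := by
  classical
  have hf : insert d T.1.1 ∈ (clusterComplex n).faces := by
    refine ⟨Finset.insert_nonempty _ _, fun e he f hf => ?_⟩
    rcases Finset.mem_insert.1 he with he' | he' <;> rcases Finset.mem_insert.1 hf with hf' | hf'
    · subst he' hf'
      rintro (⟨h, -⟩ | ⟨h, -⟩) <;> exact lt_irrefl _ h
    · exact he' ▸ h f hf'
    · exact hf' ▸ fun hc => h e he' hc.symm
    · exact T.1.2.2 e he' f hf'
  have := T.2 ⟨_, hf⟩ (Finset.subset_insert _ _)
  rw [← this]
  exact Finset.mem_insert_self _ _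

theorem edge_of_noncross (T : Tri n) {i j : ℕ} (h : i < j) (hj : j ≤ n + 2)
    (hc : ∀ k l, T.E k l → ¬ (i < k ∧ k < j ∧ j < l) ∧ ¬ (k < i ∧ i < l ∧ l < j)) : T.E i j := by
  by_cases h1 : j = i + 1
  · exact ⟨h, hj, .inl h1⟩
  by_cases h0 : i = 0 ∧ j = n + 2
  · exact ⟨h, hj, .inr (.inl h0)⟩
  refine Edge.of_mem (d := mkDiagonal i j (by omega) hj h0) (T.mem_of_noncross _ fun e he hx => ?_)
  have := hc _ _ (Edge.of_mem he)
  rcases hx with hx | hx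
  · exact this.1 hx
  · exact this.2 hx

theorem subset_of_edge {S S' : Finset (Diagonal n)} (h : ∀ i j, Edge S i j → Edge S' i j) :
    S ⊆ S' :=
  fun _ hd => (h _ _ (.of_mem hd)).mem

theorem ext_edge {T T' : Tri n} (h : ∀ i j, T.E i j → T'.E i j) : T = T' :=
  Subtype.ext (T.2 T'.1 (subset_of_edge h)).symm

/-- A noncrossing set that absorbs every diagonal that does not cross it is a triangulation. -/
theorem exists_of_maximal {S : Finset (Diagonal n)} (hne : S.Nonempty)
    (hS : ∀ d ∈ S, ∀ e ∈ S, ¬ Crosses d e) (hm : ∀ d, (∀ e ∈ S, ¬ Crosses d e) → d ∈ S) :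
    ∃ T : Tri n, T.1.1 = S :=
  ⟨⟨⟨S, hne, hS⟩, fun τ h => Subtype.ext (Finset.Subset.antisymm
    (fun d hd => hm d fun e he => τ.2.2 d hd e (h he)) h)⟩, rfl⟩

theorem side (T : Tri n) {i : ℕ} (h : i + 1 ≤ n + 2) : T.E i (i + 1) :=
  ⟨by omega, h, .inl rfl⟩

theorem top (T : Tri n) : T.E 0 (n + 2) := ⟨by omega, le_rfl, .inr (.inl ⟨rfl, rfl⟩)⟩

/-- The last edge from `x` strictly below an edge `xy` closes up to a triangle. -/
theorem edge_of_max (T : Tri n) {x y z : ℕ} (h : T.E x y) (hz : T.E x z) (hzy : z < y)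
    (hmax : ∀ w, z < w → w < y → ¬ T.E x w) : T.E z y := by
  have hx := hz.1
  refine T.edge_of_noncross hzy h.2.1 fun k l hkl => ⟨fun hc => ?_, fun hc => ?_⟩
  · exact T.nc h hkl (by omega)
  · rcases lt_trichotomy k x with hk | rfl | hk
    · exact T.nc hkl h (by omega)
    · exact hmax l (by omega) (by omega) hkl
    · exact T.nc hz hkl (by omega)

theorem exists_max_below (T : Tri n) {x y : ℕ} (hy : y ≤ n + 2) (hxy : x + 1 < y) :
    ∃ z, x < z ∧ z < y ∧ T.E x z ∧ ∀ w, z < w → w < y → ¬ T.E x w := by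
  classical
  have h1 : T.E x (x + 1) := T.side (by omega)
  refine ⟨Nat.findGreatest (fun z => T.E x z) (y - 1), ?_, ?_, ?_, ?_⟩
  · exact Nat.le_findGreatest (P := fun z => T.E x z) (by omega) h1
  · have := Nat.findGreatest_le (P := fun z => T.E x z) (y - 1); omega
  · exact Nat.findGreatest_spec (P := fun z => T.E x z) (m := x + 1) (by omega) h1
  · exact fun w hw hwy => Nat.findGreatest_is_greatest hw (by omega)

theorem inner_apex (T : Tri n) {x y : ℕ} (h : T.E x y) (hxy : x + 1 < y) :
    ∃ z, x < z ∧ z < y ∧ T.E x z ∧ T.E z y := by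
  obtain ⟨z, h1, h2, h3, h4⟩ := T.exists_max_below h.2.1 hxy
  exact ⟨z, h1, h2, h3, T.edge_of_max h h3 h2 h4⟩

/-- Descent from an enclosing edge `pq`: either the triangle below `pq` has `xy` as a side, or one
of its two lower sides still encloses `xy` and is shorter. The bound `m` on the length drives the
induction. -/
theorem outer_apex_of_le (T : Tri n) {x y : ℕ} (h : T.E x y) (m : ℕ) :
    ∀ p q, T.E p q → p ≤ x → y ≤ q → q - p ≤ m → ¬ (p = x ∧ q = y) →
      (∃ z, z < x ∧ T.E z x ∧ T.E z y) ∨ ∃ z, y < z ∧ T.E x z ∧ T.E y z := by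
  have hxy := h.1
  induction m with
  | zero => intro p q hpq _ _ _ _; omega
  | succ m ih =>
    intro p q hpq hp hq hm hne
    obtain ⟨z, h1, h2, h3, h4⟩ := T.inner_apex hpq (by omega)
    have c1 := T.nc h h4
    have c2 := T.nc h3 h
    by_cases hz : z ≤ x
    · by_cases hxz : z = x ∧ q = y
      · obtain ⟨rfl, rfl⟩ := hxz
        exact .inl ⟨p, h1, h3, hpq⟩
      · exact ih z q h4 hz hq (by omega) hxz
    · by_cases hyz : p = x ∧ z = y
      · obtain ⟨rfl, rfl⟩ := hyz
        exact .inr ⟨q, h2, hpq, h4⟩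
      · exact ih p z h3 hp (by omega) (by omega) hyz

theorem outer_apex (T : Tri n) {x y : ℕ} (h : T.E x y) (h0 : ¬ (x = 0 ∧ y = n + 2)) :
    (∃ z, z < x ∧ T.E z x ∧ T.E z y) ∨ ∃ z, y < z ∧ T.E x z ∧ T.E y z :=
  T.outer_apex_of_le h _ 0 (n + 2) T.top (by omega) h.2.1 le_rfl (by omega)

/-- Every edge that avoids the vertex `0` lies below an edge of the link of `0`. -/
theorem exists_link (T : Tri n) {b e : ℕ} (h : T.E b e) (hb : 0 < b) :
    ∃ x y, 0 < x ∧ x ≤ b ∧ e ≤ y ∧ T.E 0 x ∧ T.E 0 y ∧ T.E x y := by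
  classical
  -- The link edge joins the first neighbour `r ≥ e` of `0` to the neighbour of `0` that precedes
  -- it.
  have hex : ∃ r, e ≤ r ∧ T.E 0 r := ⟨n + 2, h.2.1, T.top⟩
  obtain ⟨hr1, hr2⟩ := Nat.find_spec hex
  have hmin : ∀ m, m < Nat.find hex → ¬ (e ≤ m ∧ T.E 0 m) := fun m hm => Nat.find_min hex hm
  generalize Nat.find hex = r at *
  have hbe := h.1
  obtain ⟨z, h1, h2, h3, h4⟩ := T.exists_max_below (x := 0) hr2.2.1 (by omega)
  refine ⟨z, r, h1, ?_, hr1, h3, hr2, T.edge_of_max hr2 h3 h2 h4⟩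
  have := hmin z h2
  have hze : z < e := by
    by_contra hc
    exact this ⟨by omega, h3⟩
  have := T.nc h3 h
  omega

/-- `T.Up T' a b c d`: the triangulation `T'` arises from `T` by the flip in the quadrilateral with
vertices `a < b < c < d` which replaces the diagonal `bd` by `ac`. -/
structure Up (T T' : Tri n) (a b c d : ℕ) : Prop where
  ab : T.E a b
  bc : T.E b c
  cd : T.E c d
  ad : T.E a d
  bd : T.E b d
  edge_iff : ∀ i j, T'.E i j ↔ (T.E i j ∧ ¬ (i = b ∧ j = d)) ∨ (i = a ∧ j = c)

/-- An edge other than `bd` that crosses `ac` would cross a side of `abcd`, and a diagonal that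
crosses `bd` but no side can only be `ac`. So the exchange leaves the set noncrossing and maximal.
The diagonals `x`, `y` are exposed for counting elements and heights. -/
theorem exists_up_aux (T : Tri n) {a b c d : ℕ} (ab : T.E a b) (bc : T.E b c) (cd : T.E c d)
    (ad : T.E a d) (bd : T.E b d) : ∃ T' : Tri n, T.Up T' a b c d ∧
      ∃ x y : Diagonal n, x.1.1.val = b ∧ x.1.2.val = d ∧ y.1.1.val = a ∧ y.1.2.val = c ∧
        T'.1.1 = insert y (T.1.1.erase x) := by
  have h1 := ab.1
  have h2 := bc.1
  have h3 := cd.1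
  have h4 := cd.2.1
  obtain ⟨x, hx1, hx2⟩ : ∃ x : Diagonal n, x.1.1.val = b ∧ x.1.2.val = d :=
    ⟨mkDiagonal b d (by omega) h4 (by omega), rfl, rfl⟩
  obtain ⟨y, hy1, hy2⟩ : ∃ y : Diagonal n, y.1.1.val = a ∧ y.1.2.val = c :=
    ⟨mkDiagonal a c (by omega) (by omega) (by omega), rfl, rfl⟩
  have key : ∀ e ∈ T.1.1, e ≠ x → ¬ Crosses y e := by
    intro e he hex hc
    have hne : ¬ (e.1.1.val = b ∧ e.1.2.val = d) := fun h =>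
      hex (Diagonal.ext_val (h.1.trans hx1.symm) (h.2.trans hx2.symm))
    have he := Edge.of_mem he
    have n1 := T.nc ab he
    have n2 := T.nc bc he
    have n3 := T.nc cd he
    have n4 := T.nc ad he
    have m1 := T.nc he ab
    have m2 := T.nc he bc
    have m3 := T.nc he cd
    have m4 := T.nc he ad
    rw [crosses_iff] at hc
    omega
  obtain ⟨T', hT'⟩ : ∃ T' : Tri n, T'.1.1 = insert y (T.1.1.erase x) := by
    refine exists_of_maximal (Finset.insert_nonempty _ _) ?_ ?_
    · intro e he f hf
      rw [Finset.mem_insert, Finset.mem_erase] at he hf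
      rcases he with rfl | he <;> rcases hf with rfl | hf
      · rintro (⟨h, -⟩ | ⟨h, -⟩) <;> exact lt_irrefl _ h
      · exact key f hf.2 hf.1
      · exact fun hc => key e he.2 he.1 hc.symm
      · exact T.1.2.2 e he.2 f hf.2
    · intro e he
      simp only [Finset.mem_insert, Finset.mem_erase] at he ⊢
      by_cases hex : Crosses e x
      · left
        have hne : ∀ {k l}, T.E k l → ¬ (k = b ∧ l = d) →
            ¬ (e.1.1.val < k ∧ k < e.1.2.val ∧ e.1.2.val < l) ∧
            ¬ (k < e.1.1.val ∧ e.1.1.val < l ∧ l < e.1.2.val) := by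
          rintro k l ⟨hkl, hl, h | h | ⟨f, hf, rfl, rfl⟩⟩ hkl'
          · omega
          · have := e.1.2.isLt; omega
          · have := he f (.inr ⟨fun h => hkl' (h ▸ ⟨hx1, hx2⟩), hf⟩)
            rw [crosses_iff] at this
            omega
        have n1 := hne ab (by omega)
        have n2 := hne bc (by omega)
        have n3 := hne cd (by omega)
        have n4 := hne ad (by omega)
        rw [crosses_iff] at hex
        have := e.2.1
        exact Diagonal.ext_val (by omega) (by omega)
      · right
        have heT : e ∈ T.1.1 := T.mem_of_noncross e fun f hf => by
          by_cases hfx : f = x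
          · exact hfx ▸ hex
          · exact he f (.inr ⟨hfx, hf⟩)
        refine ⟨?_, heT⟩
        rintro rfl
        refine he y (.inl rfl) ?_
        rw [crosses_iff]
        omega
  refine ⟨T', ⟨ab, bc, cd, ad, bd, fun i j => ?_⟩, x, y, hx1, hx2, hy1, hy2, hT'⟩
  constructor
  · rintro ⟨hij, hj, h⟩
    rcases h with h | h | ⟨e, he, rfl, rfl⟩
    · exact .inl ⟨⟨hij, hj, .inl h⟩, by omega⟩
    · exact .inl ⟨⟨hij, hj, .inr (.inl h)⟩, by omega⟩
    · rw [hT', Finset.mem_insert, Finset.mem_erase] at he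
      rcases he with rfl | he
      · exact .inr ⟨hy1, hy2⟩
      · refine .inl ⟨.of_mem he.2, fun h => he.1 (Diagonal.ext_val ?_ ?_)⟩ <;> omega
  · rintro (⟨⟨hij, hj, h⟩, hne⟩ | ⟨rfl, rfl⟩)
    · rcases h with h | h | ⟨e, he, rfl, rfl⟩
      · exact ⟨hij, hj, .inl h⟩
      · exact ⟨hij, hj, .inr (.inl h)⟩
      · refine .of_mem ?_
        rw [hT', Finset.mem_insert, Finset.mem_erase]
        exact .inr ⟨fun h => hne (h ▸ ⟨hx1, hx2⟩), he⟩
    · refine ⟨by omega, by omega, .inr (.inr ⟨y, ?_, hy1, hy2⟩)⟩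
      rw [hT']
      exact Finset.mem_insert_self _ _

theorem exists_up (T : Tri n) {a b c d : ℕ} (ab : T.E a b) (bc : T.E b c) (cd : T.E c d)
    (ad : T.E a d) (bd : T.E b d) : ∃ T' : Tri n, T.Up T' a b c d :=
  let ⟨T', h, _⟩ := T.exists_up_aux ab bc cd ad bd
  ⟨T', h⟩

theorem Up.unique {T T' T'' : Tri n} {a b c d : ℕ} (h : T.Up T' a b c d) (h' : T.Up T'' a b c d) :
    T' = T'' :=
  ext_edge fun i j hij => (h'.edge_iff i j).2 ((h.edge_iff i j).1 hij)

theorem Up.exists_insert {T T' : Tri n} {a b c d : ℕ} (h : T.Up T' a b c d) :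
    ∃ x y : Diagonal n, x.1.1.val = b ∧ x.1.2.val = d ∧ y.1.1.val = a ∧ y.1.2.val = c ∧
        x ∈ T.1.1 ∧ y ∉ T.1.1 ∧ T'.1.1 = insert y (T.1.1.erase x) := by
  obtain ⟨T'', h'', x, y, h1, h2, h3, h4, h5⟩ := T.exists_up_aux h.ab h.bc h.cd h.ad h.bd
  rw [← h.unique h''] at h5
  refine ⟨x, y, h1, h2, h3, h4, Edge.mem (by rw [h1, h2]; exact h.bd), fun hy => ?_, h5⟩
  have := Edge.of_mem hy
  rw [h3, h4] at this
  exact T.nc this h.bd ⟨h.ab.1, h.bc.1, h.cd.1⟩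

/-- The sum of the first end points of the diagonals. -/
def height (T : Tri n) : ℕ := ∑ d ∈ T.1.1, d.1.1.val

/-- The removed diagonal starts at `b`, the new one at `a < b`. -/
theorem Up.height_lt {T T' : Tri n} {a b c d : ℕ} (h : T.Up T' a b c d) :
    T'.height < T.height := by
  obtain ⟨x, y, h1, h2, h3, h4, hx, hy, h5⟩ := h.exists_insert
  have hab := h.ab.1
  rw [height, height, h5, Finset.sum_insert (fun hh => hy (Finset.mem_of_mem_erase hh)),
    ← Finset.add_sum_erase _ _ hx]
  omega

theorem Up.card_eq {T T' : Tri n} {a b c d : ℕ} (h : T.Up T' a b c d) :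
    T'.1.1.card = T.1.1.card := by
  obtain ⟨x, y, h1, h2, h3, h4, hx, hy, h5⟩ := h.exists_insert
  rw [h5, Finset.card_insert_of_notMem (fun hh => hy (Finset.mem_of_mem_erase hh)),
    Finset.card_erase_add_one hx]

/-- A triangulation is the fan at `0`, or a flip that creates a diagonal at `0` is possible. -/
theorem fan_or_exists_up (T : Tri n) :
    (∀ d, d ∈ T.1.1 ↔ d.1.1.val = 0) ∨ ∃ T' b c d, T.Up T' 0 b c d := by
  by_cases h : ∃ d ∈ T.1.1, d.1.1.val ≠ 0
  · obtain ⟨d, hd, h0⟩ := h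
    obtain ⟨x, y, hx, hxd, hyd, h1, h2, h3⟩ := T.exists_link (.of_mem hd) (by omega)
    have := d.2.1
    obtain ⟨z, hz1, hz2, h4, h5⟩ := T.inner_apex h3 (by omega)
    obtain ⟨T', h'⟩ := T.exists_up h1 h4 h5 h2 h3
    exact .inr ⟨T', _, _, _, h'⟩
  · push Not at h
    refine .inl fun d => ⟨h d, fun hd => T.mem_of_noncross d fun e he hc => ?_⟩
    have := h e he
    rw [crosses_iff] at hc
    omega

theorem card_first_eq_zero : (Finset.univ.filter fun d : Diagonal n => d.1.1.val = 0).card = n := by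
  have : (Finset.univ.filter fun d : Diagonal n => d.1.1.val = 0).card =
      (Finset.Ico 2 (n + 2)).card := by
    refine Finset.card_bij (fun d _ => d.1.2.val) ?_ ?_ ?_
    · intro d hd
      have := d.2
      have := d.1.2.isLt
      simp only [Finset.mem_filter, Finset.mem_univ, true_and, Finset.mem_Ico] at hd ⊢
      omega
    · intro d hd e he h
      simp only [Finset.mem_filter, Finset.mem_univ, true_and] at hd he
      exact Diagonal.ext_val (by omega) h
    · intro j hj
      simp only [Finset.mem_Ico] at hj
      exact ⟨mkDiagonal 0 j (by omega) (by omega) (by omega), by simp [mkDiagonal], rfl⟩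
  rw [this, Nat.card_Ico]
  omega

theorem up_induction {P : Tri n → Prop} (h : ∀ T : Tri n, (∀ T' a b c d, T.Up T' a b c d → P T') →
    P T) (T : Tri n) : P T := by
  induction hm : T.height using Nat.strong_induction_on generalizing T with
  | _ m ih => exact h T fun T' a b c d hT => ih _ (hm ▸ hT.height_lt) T' rfl

/-- Flips preserve the number of diagonals, and descending flips end at the fan at `0`, which has
`n`. -/
theorem card_eq (T : Tri n) : T.1.1.card = n := by
  induction T using up_induction with
  | _ T ih =>
    rcases T.fan_or_exists_up with h | ⟨T', b, c, d, h⟩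
    · refine Eq.trans ?_ (card_first_eq_zero (n := n))
      congr 1
      ext d
      simp [h]
    · rw [← h.card_eq, ih _ _ _ _ _ h]

theorem Up.near {T T' : Tri n} (hn : 2 ≤ n) {a b c d : ℕ} (h : T.Up T' a b c d) :
    QNear (n - 2) T.1 T'.1 := by
  obtain ⟨x, y, h1, h2, h3, h4, hx, hy, h5⟩ := h.exists_insert
  have hc : (T.1.1.erase x).card = n - 2 + 1 := by
    rw [Finset.card_erase_of_mem hx, T.card_eq]; omega
  refine ⟨⟨T.1.1.erase x, Finset.card_pos.1 (by omega), fun d hd e he =>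
    T.1.2.2 d (Finset.mem_of_mem_erase hd) e (Finset.mem_of_mem_erase he)⟩, hc,
    Finset.erase_subset _ _, ?_⟩
  rw [h5]
  exact Finset.subset_insert _ _

theorem near_refl (hn : 2 ≤ n) (T : Tri n) : QNear (n - 2) T.1 T.1 := by
  obtain ⟨S, hS, hc⟩ := Finset.exists_subset_card_eq (s := T.1.1) (n := n - 2 + 1)
    (by rw [T.card_eq]; omega)
  exact ⟨⟨S, Finset.card_pos.1 (by omega), fun d hd e he => T.1.2.2 d (hS hd) e (hS he)⟩, hc,
    hS, hS⟩

/-- The only way to replace a diagonal of a triangulation is to flip it. -/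
theorem up_or_up_of_subset {T T' : Tri n} {u : Diagonal n} (hu : u ∈ T.1.1)
    (huT' : u ∉ T'.1.1) (h : T.1.1.erase u ⊆ T'.1.1) :
    ∃ a b c d, (u.1.1.val = b ∧ u.1.2.val = d ∧ T.Up T' a b c d) ∨
      (u.1.1.val = a ∧ u.1.2.val = c ∧ T'.Up T a b c d) := by
  have hE : ∀ {i j}, T.E i j → ¬ (i = u.1.1.val ∧ j = u.1.2.val) → T'.E i j := by
    rintro i j ⟨h1, h2, h' | h' | ⟨e, he, rfl, rfl⟩⟩ hne
    · exact ⟨h1, h2, .inl h'⟩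
    · exact ⟨h1, h2, .inr (.inl h')⟩
    · exact .of_mem (h (Finset.mem_erase.2 ⟨fun h => hne (h ▸ ⟨rfl, rfl⟩), he⟩))
  -- The sides of the quadrilateral around `u` survive in `T'`, so a diagonal `v` of `T'` that
  -- crosses `u` must be the other diagonal of it. The position of the outer apex decides which of
  -- the two flips is the descending one.
  have hcross : ∃ v ∈ T'.1.1, Crosses u v := by
    by_contra! hc
    exact huT' (T'.mem_of_noncross u hc)
  obtain ⟨v, hv, hvu⟩ := hcross
  have ev := Edge.of_mem hv
  have huE := Edge.of_mem hu
  have hu2 := u.2.1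
  obtain ⟨z, hz1, hz2, h3, h4⟩ := T.inner_apex huE (by omega)
  have e3 := hE h3 (by omega)
  have e4 := hE h4 (by omega)
  have p1 := T'.nc ev e3
  have p2 := T'.nc e3 ev
  have p3 := T'.nc ev e4
  have p4 := T'.nc e4 ev
  rw [crosses_iff] at hvu
  rcases T.outer_apex huE u.2.2 with ⟨w, hw, h5, h6⟩ | ⟨w, hw, h5, h6⟩
  · refine ⟨w, u.1.1.val, z, u.1.2.val, .inl ⟨rfl, rfl, ?_⟩⟩
    have e5 := hE h5 (by omega)
    have e6 := hE h6 (by omega)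
    have p5 := T'.nc ev e5
    have p6 := T'.nc e5 ev
    have p7 := T'.nc ev e6
    have p8 := T'.nc e6 ev
    obtain ⟨T'', h''⟩ := T.exists_up h5 h3 h4 h6 huE
    have : T'' = T' := ext_edge fun i j hij => by
      rcases (h''.edge_iff i j).1 hij with h | ⟨rfl, rfl⟩
      · exact hE h.1 h.2
      · have h1 : v.1.1.val = i := by omega
        have h2 : v.1.2.val = j := by omega
        rw [← h1, ← h2]; exact ev
    exact this ▸ h''
  · refine ⟨u.1.1.val, z, u.1.2.val, w, .inr ⟨rfl, rfl, ?_⟩⟩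
    have e5 := hE h5 (by omega)
    have e6 := hE h6 (by omega)
    have p5 := T'.nc ev e5
    have p6 := T'.nc e5 ev
    have p7 := T'.nc ev e6
    have p8 := T'.nc e6 ev
    have h1 : v.1.1.val = z := by omega
    have h2 : v.1.2.val = w := by omega
    rw [h1, h2] at ev
    obtain ⟨T'', h''⟩ := T'.exists_up e3 e4 e6 e5 ev
    have : T = T'' := ext_edge fun i j hij => by
      rw [h''.edge_iff]
      by_cases hiu : i = u.1.1.val ∧ j = u.1.2.val
      · exact .inr hiu
      · refine .inl ⟨hE hij hiu, ?_⟩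
        rintro ⟨rfl, rfl⟩
        exact T.nc huE hij (by omega)
    exact this ▸ h''

/-- A common face has `n - 1` diagonals, one less than `T`, so it consists of all diagonals of `T`
except `u`. -/
theorem erase_subset_of_near {T : Tri n} (hn : 2 ≤ n) {σ : Simplex (clusterComplex n)}
    (h : QNear (n - 2) T.1 σ) {u : Diagonal n} (hu : u ∈ T.1.1) (hu' : u ∉ σ.1) :
    T.1.1.erase u ⊆ σ.1 := by
  obtain ⟨ρ, hc, h1, h2⟩ := h
  have : ρ.1 = T.1.1.erase u := by
    refine Finset.eq_of_subset_of_card_le (fun d hd => Finset.mem_erase.2 ⟨?_, h1 hd⟩) ?_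
    · rintro rfl; exact hu' (h2 hd)
    · rw [Finset.card_erase_of_mem hu, T.card_eq, hc]; omega
  rwa [← this]

theorem exists_mem_of_ne {T T' : Tri n} (hne : T ≠ T') : ∃ u ∈ T.1.1, u ∉ T'.1.1 := by
  by_contra! hc
  exact hne (Subtype.ext (T.2 T'.1 hc).symm)

theorem up_or_up_of_near {T T' : Tri n} (hn : 2 ≤ n) (h : QNear (n - 2) T.1 T'.1) (hne : T ≠ T') :
    ∃ a b c d, T.Up T' a b c d ∨ T'.Up T a b c d := by
  obtain ⟨u, hu, hu'⟩ := exists_mem_of_ne hne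
  obtain ⟨a, b, c, d, h⟩ := up_or_up_of_subset hu hu' (erase_subset_of_near hn h hu hu')
  exact ⟨a, b, c, d, h.imp (fun h => h.2.2) (fun h => h.2.2)⟩

end Tri

end Basic

/-! ### Commuting flips. -/

/-- The segment `qs` is neither a side nor the diagonal `bd` of the quadrilateral `abcd`. -/
def Indep (a b c d q s : ℕ) : Prop :=
  ¬ (q = a ∧ s = b) ∧ ¬ (q = b ∧ s = c) ∧ ¬ (q = c ∧ s = d) ∧ ¬ (q = a ∧ s = d) ∧
    ¬ (q = b ∧ s = d)

namespace Tri

variable {n : ℕ}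

/-- Independence means that the quadrilaterals around `bd` and `qs` have no triangle of `T` in
common, which is a symmetric condition. -/
theorem Up.indep_symm {T T₁ T₂ : Tri n} {a b c d p q r s : ℕ} (h₁ : T.Up T₁ a b c d)
    (h₂ : T.Up T₂ p q r s) (h : Indep a b c d q s) : Indep p q r s b d := by
  obtain ⟨i1, i2, i3, i4, i5⟩ := h
  have := h₁.ab.1
  have := h₁.bc.1
  have := h₁.cd.1
  have := h₂.ab.1
  have := h₂.bc.1
  have := h₂.cd.1
  have m1 := T.nc h₁.ad h₂.ad
  have m2 := T.nc h₁.ad h₂.bd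
  have m3 := T.nc h₁.ab h₂.bd
  have m4 := T.nc h₂.bc h₁.ad
  have m5 := T.nc h₁.bc h₂.bd
  have m6 := T.nc h₂.ab h₁.cd
  refine ⟨?_, ?_, ?_, ?_, ?_⟩ <;> rintro ⟨rfl, rfl⟩ <;> omega

theorem Up.edge_of_ne {T T' : Tri n} {a b c d i j : ℕ} (h : T.Up T' a b c d) (e : T.E i j)
    (hne : ¬ (i = b ∧ j = d)) : T'.E i j :=
  (h.edge_iff i j).2 (.inl ⟨e, hne⟩)

theorem Up.edge_new {T T' : Tri n} {a b c d : ℕ} (h : T.Up T' a b c d) : T'.E a c :=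
  (h.edge_iff a c).2 (.inr ⟨rfl, rfl⟩)

/-- Flips in quadrilaterals without common triangle commute. -/
theorem Up.commute {T T₁ T₂ : Tri n} {a b c d p q r s : ℕ} (h₁ : T.Up T₁ a b c d)
    (h₂ : T.Up T₂ p q r s) (h : Indep a b c d q s) :
    ∃ T₃, T₁.Up T₃ p q r s ∧ T₂.Up T₃ a b c d := by
  have h' := h₁.indep_symm h₂ h
  have A : ∀ {T T₁ T₂ : Tri n} {a b c d p q r s : ℕ}, T.Up T₁ a b c d → T.Up T₂ p q r s →
      Indep a b c d q s → Indep p q r s b d → ∃ T₃, T₁.Up T₃ p q r s := by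
    intro T T₁ T₂ a b c d p q r s h₁ h₂ h h'
    obtain ⟨i1, i2, i3, i4, i5⟩ := h'
    exact exists_up _ (h₁.edge_of_ne h₂.ab (by omega)) (h₁.edge_of_ne h₂.bc (by omega))
      (h₁.edge_of_ne h₂.cd (by omega)) (h₁.edge_of_ne h₂.ad (by omega))
      (h₁.edge_of_ne h₂.bd (by omega))
  obtain ⟨T₃, h₃⟩ := A h₁ h₂ h h'
  obtain ⟨T₄, h₄⟩ := A h₂ h₁ h' h
  have : T₃ = T₄ := ext_edge fun i j hij => by
    -- Neither flip creates the diagonal that the other removes, since a created diagonal crosses an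
    -- edge of `T`.
    have n1 : ¬ (a = q ∧ c = s) := by
      rintro ⟨rfl, rfl⟩
      exact T.nc h₂.bd h₁.bd ⟨h₁.ab.1, h₁.bc.1, h₁.cd.1⟩
    have n2 : ¬ (p = b ∧ r = d) := by
      rintro ⟨rfl, rfl⟩
      exact T.nc h₁.bd h₂.bd ⟨h₂.ab.1, h₂.bc.1, h₂.cd.1⟩
    rw [h₄.edge_iff, h₂.edge_iff]
    rw [h₃.edge_iff, h₁.edge_iff] at hij
    rcases hij with ⟨⟨hij, k1⟩ | ⟨rfl, rfl⟩, k2⟩ | ⟨rfl, rfl⟩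
    · exact .inl ⟨.inl ⟨hij, k2⟩, k1⟩
    · exact .inr ⟨rfl, rfl⟩
    · exact .inl ⟨.inr ⟨rfl, rfl⟩, n2⟩
  exact ⟨T₃, h₃, this ▸ h₄⟩

/-! ### Flat functions on the flip graph. -/

section Cocycle

variable {A : Type*} [AddCommGroup A]

/-- A function on pairs of triangulations is flat if it sums to zero around squares of commuting
flips. -/
def Flat (f : Tri n → Tri n → A) : Prop :=
  ∀ ⦃T T₁ T₂ T₃ : Tri n⦄ ⦃a b c d p q r s : ℕ⦄, T.Up T₁ a b c d → T.Up T₂ p q r s →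
    T₁.Up T₃ p q r s → T₂.Up T₃ a b c d → f T T₁ + f T₁ T₃ = f T T₂ + f T₂ T₃

open Classical in
/-- The sum of `f` along a path of flips from `T` to the fan at the vertex `0`, where each flip
creates a diagonal at `0`. -/
noncomputable def potential (f : Tri n → Tri n → A) (T : Tri n) : A :=
  if hT : ∃ T' b c d, T.Up T' 0 b c d then f T hT.choose + potential f hT.choose else 0
termination_by T.height
decreasing_by
  obtain ⟨b, c, d, h⟩ := hT.choose_spec
  exact h.height_lt

theorem exists_potential_eq (f : Tri n → Tri n → A) {T T₁ : Tri n} {b c d : ℕ}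
    (h : T.Up T₁ 0 b c d) :
    ∃ T₂ b' c' d', T.Up T₂ 0 b' c' d' ∧ potential f T = f T T₂ + potential f T₂ := by
  have hT : ∃ T' b c d, T.Up T' 0 b c d := ⟨T₁, b, c, d, h⟩
  obtain ⟨b', c', d', h'⟩ := hT.choose_spec
  have e : potential f T = f T hT.choose + potential f hT.choose := by
    rw [potential.eq_def]
    exact dif_pos hT
  exact ⟨hT.choose, b', c', d', h', e⟩

/-- The removed diagonals `bd` and `b'd'` are edges of the link of `0`. The sides `bc` and `cd` are
cut off from `0` by `bd`, so they are not in the link, and the other two sides contain `0`. -/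
theorem Up.indep_zero {T T₁ T₂ : Tri n} {b c d b' c' d' : ℕ} (h₁ : T.Up T₁ 0 b c d)
    (h₂ : T.Up T₂ 0 b' c' d') : T₁ = T₂ ∨ Indep 0 b c d b' d' := by
  by_cases hbd : b' = b ∧ d' = d
  · obtain ⟨rfl, rfl⟩ := hbd
    left
    have : c = c' := by
      have m1 := T.nc h₁.bc h₂.cd
      have m2 := T.nc h₂.bc h₁.cd
      have := h₁.bc.1
      have := h₁.cd.1
      have := h₂.bc.1
      have := h₂.cd.1
      omega
    subst this
    exact h₁.unique h₂
  · right
    have m1 := T.nc h₂.ad h₁.bd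
    have m2 := T.nc h₂.ab h₁.bd
    have := h₁.ab.1
    have := h₁.bc.1
    have := h₁.cd.1
    have := h₂.ab.1
    refine ⟨?_, ?_, ?_, ?_, hbd⟩ <;> omega

/-- The diamond argument: if `h` is not the flip chosen in `potential`, the two commute, and
induction applies to both lower sides of the square. -/
theorem Flat.potential_sub {f : Tri n → Tri n → A} (hf : Flat f) (T : Tri n) :
    ∀ {T₁ : Tri n} {b c d : ℕ}, T.Up T₁ 0 b c d → f T T₁ = potential f T - potential f T₁ := by
  induction T using up_induction with
  | _ T ih =>
  intro T₁ b c d h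
  obtain ⟨T₂, b', c', d', h₂, hp⟩ := exists_potential_eq f h
  rcases h.indep_zero h₂ with rfl | hi
  · rw [hp]; abel
  · obtain ⟨T₃, h3, h4⟩ := h.commute h₂ hi
    have e1 := ih _ _ _ _ _ h h3
    have e2 := ih _ _ _ _ _ h₂ h4
    have e3 := hf h h₂ h3 h4
    rw [e1, e2] at e3
    rw [hp, eq_sub_of_add_eq e3]
    abel

/-- A function on pairs of triangulations is normalized if it vanishes on the flips that create a
diagonal at the vertex `0`. -/
def Normalized (f : Tri n → Tri n → A) : Prop :=
  ∀ ⦃T T₁ : Tri n⦄ ⦃b c d : ℕ⦄, T.Up T₁ 0 b c d → f T T₁ = 0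

theorem Flat.sub_potential {f : Tri n → Tri n → A} (hf : Flat f) :
    Flat (fun T T' => f T T' - potential f T + potential f T') ∧
      Normalized (fun T T' => f T T' - potential f T + potential f T') := by
  refine ⟨fun T T₁ T₂ T₃ a b c d p q r s h1 h2 h3 h4 => ?_, fun T T₁ b c d h => ?_⟩
  · have := hf h1 h2 h3 h4
    beta_reduce
    calc _ = (f T T₁ + f T₁ T₃) - potential f T + potential f T₃ := by abel
      _ = _ := by rw [this]; abel
  · simp only [hf.potential_sub T h]
    abel

variable {f : Tri n → Tri n → A}

/-- In the commuting square the two opposite sides that create a diagonal at `0` contribute nothing.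
-/
theorem Flat.eq_of_zero_up (hf : Flat f) (h0 : Normalized f) {T T₁ T₂ T₃ : Tri n}
    {b c d p q r s : ℕ} (h₁ : T.Up T₁ 0 b c d) (h₂ : T.Up T₂ p q r s) (hi : Indep 0 b c d q s)
    (h₃ : T₁.Up T₃ p q r s) : f T T₂ = f T₁ T₃ := by
  obtain ⟨T₃', h3, h4⟩ := h₁.commute h₂ hi
  obtain rfl := h₃.unique h3
  have := hf h₁ h₂ h3 h4
  rw [h0 h₁, h0 h4, zero_add, add_zero] at this
  exact this.symm

/-- Four of the five sides of a pentagon `0abcd` of triangulations create diagonals at `0`. -/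
theorem Flat.eq_of_pentagon (hf : Flat f) (h0 : Normalized f) {T T₁ T₂ T₃ : Tri n}
    {a b c d p q r s : ℕ} (ha : 0 < a) (hp : 0 < p) (e₁ : T.E 0 a) (e₂ : T.E 0 d)
    (h₁ : T.Up T₁ a b c d) (h₂ : T.Up T₂ p q r s) (hi : Indep a b c d q s)
    (h₃ : T₁.Up T₃ p q r s) : f T T₂ = f T₁ T₃ := by
  obtain ⟨i1, i2, i3, i4, i5⟩ := hi
  have oab := h₁.ab.1
  have obc := h₁.bc.1
  have ocd := h₁.cd.1
  have oqs := h₂.ab.1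
  -- The pentagon `0abcd` is closed by `T → X → Z`, creating `0b` and then `0c`, and by `T₁ → Y →
  -- Z`, creating `0c` and then `0b`. These four flips create diagonals at `0`, so the value on the
  -- flip in `pqrs` can be carried from `T` and from `T₁` to the common end `Z`.
  obtain ⟨X, hX⟩ := T.exists_up e₁ h₁.ab h₁.bd e₂ h₁.ad
  obtain ⟨Z, hZ⟩ := X.exists_up hX.edge_new (hX.edge_of_ne h₁.bc (by omega))
    (hX.edge_of_ne h₁.cd (by omega)) (hX.edge_of_ne e₂ (by omega))
    (hX.edge_of_ne h₁.bd (by omega))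
  obtain ⟨Y, hY⟩ := T₁.exists_up (h₁.edge_of_ne e₁ (by omega)) h₁.edge_new
    (h₁.edge_of_ne h₁.cd (by omega)) (h₁.edge_of_ne e₂ (by omega))
    (h₁.edge_of_ne h₁.ad (by omega))
  obtain ⟨Z', hZ'⟩ := Y.exists_up (hY.edge_of_ne (h₁.edge_of_ne e₁ (by omega)) (by omega))
    (hY.edge_of_ne (h₁.edge_of_ne h₁.ab (by omega)) (by omega))
    (hY.edge_of_ne (h₁.edge_of_ne h₁.bc (by omega)) (by omega))
    hY.edge_new
    (hY.edge_of_ne h₁.edge_new (by omega))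
  have hZZ : Z = Z' := ext_edge fun i j hij => by
    rw [hZ.edge_iff, hX.edge_iff] at hij
    rw [hZ'.edge_iff, hY.edge_iff, h₁.edge_iff]
    by_cases hac : i = a ∧ j = c
    · obtain ⟨rfl, rfl⟩ := hac
      rcases hij with ⟨⟨hij, -⟩ | hij, -⟩ | hij
      · exact absurd ⟨oab, obc, ocd⟩ (T.nc hij h₁.bd)
      · omega
      · omega
    · rcases hij with ⟨⟨hij, k1⟩ | k1, k2⟩ | k1
      · exact .inl ⟨.inl ⟨.inl ⟨hij, k2⟩, k1⟩, hac⟩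
      · exact .inr k1
      · exact .inl ⟨.inr k1, hac⟩
  subst hZZ
  have hqac : ¬ (q = a ∧ s = c) := by
    rintro ⟨rfl, rfl⟩
    exact T.nc h₂.bd h₁.bd ⟨oab, obc, ocd⟩
  have j1 : Indep 0 a b d q s := ⟨by omega, by omega, by omega, by omega, by omega⟩
  have j2 : Indep 0 b c d q s := ⟨by omega, by omega, by omega, by omega, by omega⟩
  have j3 : Indep 0 a c d q s := ⟨by omega, by omega, by omega, by omega, by omega⟩
  have j4 : Indep 0 a b c q s := ⟨by omega, by omega, by omega, by omega, by omega⟩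
  obtain ⟨XR, hXR, -⟩ := hX.commute h₂ j1
  obtain ⟨ZR, hZR, -⟩ := hZ.commute hXR j2
  obtain ⟨YR, hYR, -⟩ := hY.commute h₃ j3
  rw [hf.eq_of_zero_up h0 hX h₂ j1 hXR, hf.eq_of_zero_up h0 hZ hXR j2 hZR,
    hf.eq_of_zero_up h0 hY h₃ j3 hYR, hf.eq_of_zero_up h0 hZ' hYR j4 hZR]

/-- A flat normalized function does not change when a flip is moved across a commuting one. -/
theorem Flat.eq_of_indep (hf : Flat f) (h0 : Normalized f) (T : Tri n) :
    ∀ {T₁ T₂ T₃ : Tri n} {a b c d p q r s : ℕ}, 0 < a → 0 < p → T.Up T₁ a b c d →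
      T.Up T₂ p q r s → Indep a b c d q s → T₁.Up T₃ p q r s → f T T₂ = f T₁ T₃ := by
  induction T using up_induction with
  | _ T ih =>
  intro T₁ T₂ T₃ a b c d p q r s ha hp h₁ h₂ hi h₃
  obtain ⟨x, y, hx, hxa, hdy, e1, e2, e3⟩ := T.exists_link h₁.ad ha
  have oab := h₁.ab.1
  have obc := h₁.bc.1
  have ocd := h₁.cd.1
  by_cases hxy : x = a ∧ y = d
  · obtain ⟨rfl, rfl⟩ := hxy
    exact hf.eq_of_pentagon h0 ha hp e1 e2 h₁ h₂ hi h₃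
  obtain ⟨z, hz1, hz2, e4, e5⟩ := T.inner_apex e3 (by omega)
  obtain ⟨G, hG⟩ := T.exists_up e1 e4 e5 e2 e3
  have k1 : Indep a b c d x y := ⟨by omega, by omega, by omega, by omega, by omega⟩
  -- If `xy` is the outer side of `pqrs`, the pentagon lemma applies with the two flips exchanged,
  -- and flatness transfers the equality to the other pair of opposite sides of the square.
  by_cases hps : x = p ∧ y = s
  · obtain ⟨rfl, rfl⟩ := hps
    have hi' := h₁.indep_symm h₂ hi
    obtain ⟨T₃', h3, h4⟩ := h₁.commute h₂ hi
    obtain rfl := h₃.unique h3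
    have := hf.eq_of_pentagon h0 hp ha e1 e2 h₂ h₁ hi' h4
    have e := hf h₁ h₂ h3 h4
    rw [this, add_comm] at e
    exact (add_right_cancel e).symm
  have opq := h₂.ab.1
  have oqr := h₂.bc.1
  have ors := h₂.cd.1
  have k2 : Indep p q r s x y := by
    have m1 := T.nc e1 h₂.ad
    have m2 := T.nc e2 h₂.bd
    have m3 := T.nc e2 h₂.ad
    have m4 := T.nc e1 h₂.bd
    refine ⟨?_, ?_, ?_, ?_, ?_⟩ <;> omega
  have k1' := h₁.indep_symm hG k1
  have k2' := h₂.indep_symm hG k2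
  obtain ⟨GR, hGR, hR⟩ := hG.commute h₂ k2'
  obtain ⟨GQ, hGQ, hQ⟩ := hG.commute h₁ k1'
  obtain ⟨GQR, hGQR, -⟩ := hQ.commute h₃ k2'
  rw [hf.eq_of_zero_up h0 hG h₂ k2' hGR, hf.eq_of_zero_up h0 hQ h₃ k2' hGQR]
  exact ih _ _ _ _ _ hG ha hp hGQ hGR hi hGQR

/-- No height decreasing flip is possible away from the quadrilateral `abcd`. -/
def Terminal (T : Tri n) (a b c d : ℕ) : Prop :=
  ∀ ⦃T' : Tri n⦄ ⦃p q r s : ℕ⦄, T.Up T' p q r s → ¬ Indep a b c d q s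

/-- Independent flips are carried out as long as possible; the height decreases and the value on the
flip in `abcd` does not change. -/
theorem Flat.exists_terminal (hf : Flat f) (h0 : Normalized f) {a b c d : ℕ} (ha : 0 < a)
    (T : Tri n) : ∀ {T₁ : Tri n}, T.Up T₁ a b c d →
      ∃ S S₁ : Tri n, S.Up S₁ a b c d ∧ S.Terminal a b c d ∧ f T T₁ = f S S₁ := by
  induction T using up_induction with
  | _ T ih =>
  intro T₁ h₁
  by_cases hT : T.Terminal a b c d
  · exact ⟨T, T₁, h₁, hT, rfl⟩
  · simp only [Terminal] at hT
    push Not at hT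
    obtain ⟨T₂, p, q, r, s, h₂, hi⟩ := hT
    obtain ⟨T₃, h3, h4⟩ := h₁.commute h₂ hi
    obtain ⟨S, S₁, hS, hSt, he⟩ := ih _ _ _ _ _ h₂ h4
    refine ⟨S, S₁, hS, hSt, he ▸ ?_⟩
    have hi' := h₁.indep_symm h₂ hi
    rcases Nat.eq_zero_or_pos p with rfl | hp
    · exact hf.eq_of_zero_up h0 h₂ h₁ hi' h4
    · exact hf.eq_of_indep h0 T hp ha h₂ h₁ hi' h4

/-- If the outer apex of `xy` lies to the left, `xy` can be flipped downwards, so by terminality it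
is a side of `abcd` or `bd`. If it lies at `w > y`, then `xw` is a longer edge from the same vertex,
and the argument is repeated. -/
theorem Terminal.exists_above {T : Tri n} {a b c d : ℕ}
    (hT : T.Terminal a b c d) (m : ℕ) : ∀ {x y : ℕ}, n + 2 - y ≤ m → T.E x y → 0 < x → x + 1 < y →
      ∃ y', y ≤ y' ∧ ¬ Indep a b c d x y' := by
  induction m with
  | zero =>
    intro x y hy e hx hxy
    obtain ⟨z, h1, h2, h3, h4⟩ := T.inner_apex e hxy
    rcases T.outer_apex e (by omega) with ⟨w, h5, h6, h7⟩ | ⟨w, h5, h6, h7⟩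
    · obtain ⟨T', h'⟩ := T.exists_up h6 h3 h4 h7 e
      exact ⟨y, le_rfl, hT h'⟩
    · have := h7.2.1; omega
  | succ m ih =>
    intro x y hy e hx hxy
    obtain ⟨z, h1, h2, h3, h4⟩ := T.inner_apex e hxy
    rcases T.outer_apex e (by omega) with ⟨w, h5, h6, h7⟩ | ⟨w, h5, h6, h7⟩
    · obtain ⟨T', h'⟩ := T.exists_up h6 h3 h4 h7 e
      exact ⟨y, le_rfl, hT h'⟩
    · obtain ⟨y', h8, h9⟩ := ih (by omega) h6 hx (by omega)
      exact ⟨y', by omega, h9⟩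

/-- By `Terminal.exists_above`, an edge that is not a side of the polygon and avoids `0` starts at
`a`, `b` or `c`. Thus a terminal triangulation consists of fans at `0`, `a`, `b`, `c` around the
quadrilateral. -/
theorem Terminal.edge_imp {T T₁ : Tri n} {a b c d : ℕ} (ha : 0 < a) (h : T.Up T₁ a b c d)
    (hT : T.Terminal a b c d) {i j : ℕ} (e : T.E i j) :
    j = i + 1 ∨ (i = 0 ∧ (j ≤ a ∨ d ≤ j)) ∨ (i = a ∧ (j ≤ b ∨ j = d)) ∨
      (i = b ∧ (j ≤ c ∨ j = d)) ∨ (i = c ∧ j ≤ d) := by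
  by_cases h1 : j = i + 1
  · exact .inl h1
  have hij := e.1
  have oab := h.ab.1
  have obc := h.bc.1
  have ocd := h.cd.1
  have m1 := T.nc e h.ad
  have m2 := T.nc e h.bd
  have m3 := T.nc e h.cd
  by_cases hi : i = 0
  · omega
  obtain ⟨y, hy, hy'⟩ := hT.exists_above _ le_rfl e (by omega) (by omega)
  simp only [Indep] at hy'
  omega

/-- The segments listed in `Terminal.edge_imp` are pairwise noncrossing, so by maximality each edge
of one terminal triangulation lies in the other. -/
theorem Terminal.unique {T T₁ S S₁ : Tri n} {a b c d : ℕ} (ha : 0 < a) (h : T.Up T₁ a b c d)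
    (hT : T.Terminal a b c d) (h' : S.Up S₁ a b c d) (hS : S.Terminal a b c d) : T = S := by
  refine ext_edge fun i j hij => S.edge_of_noncross hij.1 hij.2.1 fun k l hkl => ?_
  have h1 := hT.edge_imp ha h hij
  have h2 := hS.edge_imp ha h' hkl
  have := h.ab.1
  have := h.bc.1
  have := h.cd.1
  omega

/-- Flat functions on the flip graph up to coboundaries are functions of the quadrilaterals that
avoid the vertex `0`. -/
theorem Flat.exists_eq (hf : Flat f) : ∃ (h : Tri n → A) (ψ : ℕ → ℕ → ℕ → ℕ → A),
    ∀ ⦃T T' : Tri n⦄ ⦃a b c d : ℕ⦄, T.Up T' a b c d →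
      f T T' = h T - h T' + if a = 0 then 0 else ψ a b c d := by
  classical
  obtain ⟨hf', h0⟩ := hf.sub_potential
  have key : ∀ a b c d : ℕ, ∃ x : A, 0 < a → ∀ T T' : Tri n, T.Up T' a b c d →
      f T T' - potential f T + potential f T' = x := by
    intro a b c d
    by_cases hex : 0 < a ∧ ∃ T T' : Tri n, T.Up T' a b c d
    · obtain ⟨ha, T, T', hT⟩ := hex
      refine ⟨f T T' - potential f T + potential f T', fun _ S S' hS => ?_⟩
      -- Both flips are moved to the same terminal triangulation, hence have the same value.
      obtain ⟨U, U', h1, h2, h3⟩ := hf'.exists_terminal h0 ha T hT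
      obtain ⟨V, V', h4, h5, h6⟩ := hf'.exists_terminal h0 ha S hS
      obtain rfl := h2.unique ha h1 h4 h5
      obtain rfl := h1.unique h4
      exact h6.trans h3.symm
    · exact ⟨0, fun ha T T' h => absurd ⟨ha, T, T', h⟩ hex⟩
  choose ψ hψ using key
  refine ⟨potential f, ψ, fun T T' a b c d h => ?_⟩
  rcases Nat.eq_zero_or_pos a with rfl | ha
  · rw [if_pos rfl, hf.potential_sub T h, add_zero]
  · rw [if_neg ha.ne', ← hψ a b c d ha T T' h]
    abel

end Cocycle

end Tri

/-! ### Balanced functions and the abelianized group. -/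

section Weight

variable {ι : Type*} {Δ : AbstractSimplicialComplex ι} {q : ℕ} {A : Type*} [AddCommGroup A]

namespace QChain

/-- The sum of `f` over the steps of a chain. -/
def weight (f : Simplex Δ → Simplex Δ → A) : {σ τ : Simplex Δ} → QChain Δ q σ τ → A
  | _, _, nil _ => 0
  | σ, _, @cons _ _ _ _ τ _ _ p => f σ τ + weight f p

variable {f : Simplex Δ → Simplex Δ → A}

theorem weight_append {σ τ υ : Simplex Δ} (p : QChain Δ q σ τ) (r : QChain Δ q τ υ) :
    (p.append r).weight f = p.weight f + r.weight f := by
  induction p with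
  | nil => simp [append, weight]
  | cons h p ih => simp [append, weight, ih, add_assoc]

variable (q f) in
/-- `f` vanishes on constant steps and sums to zero around closed walks of length four. -/
structure Balanced : Prop where
  self : ∀ ⦃σ⦄, QNear q σ σ → f σ σ = 0
  square : ∀ ⦃σ τ σ' τ'⦄, QNear q σ τ → QNear q σ σ' → QNear q τ τ' → QNear q σ' τ' →
    f σ τ + f τ τ' = f σ σ' + f σ' τ'

/-- A degenerate square with two constant steps. -/
theorem Balanced.add_swap (hf : Balanced q f) {σ τ : Simplex Δ} (h : QNear q σ τ) :
    f σ τ + f τ σ = 0 := by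
  rw [hf.square h h.left h.symm h.left, hf.self h.left, add_zero]

theorem Balanced.weight_reverse (hf : Balanced q f) {σ τ : Simplex Δ} (p : QChain Δ q σ τ) :
    p.reverse.weight f = - p.weight f := by
  induction p with
  | nil => simp [reverse, weight]
  | cons h p ih =>
    rw [reverse, weight_append, ih, weight, weight, weight, add_zero,
      eq_neg_of_add_eq_zero_right (hf.add_swap h)]
    abel

theorem Balanced.weight_stretch (hf : Balanced q f) {σ τ : Simplex Δ} {p p' : QChain Δ q σ τ}
    (h : Stretch p p') : p.weight f = p'.weight f := by
  induction h with
  | here h p => simp [weight, hf.self h]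
  | there h _ ih => simp [weight, ih]

/-- The squares between the two rows are added up; only the outermost vertical steps remain. -/
theorem Balanced.weight_rowNear (hf : Balanced q f) {σ τ σ' τ' : Simplex Δ} {p : QChain Δ q σ τ}
    {p' : QChain Δ q σ' τ'} (h : RowNear p p') :
    p.weight f + f τ τ' = f σ σ' + p'.weight f := by
  induction h with
  | nil v => simp [weight]
  | cons h h' v hr ih =>
    rw [weight, weight, add_assoc, ih, ← add_assoc, hf.square h v hr.left_start h', add_assoc]

theorem Balanced.weight_homotopic (hf : Balanced q f) {σ τ : Simplex Δ} {p p' : QChain Δ q σ τ}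
    (h : Homotopic p p') : p.weight f = p'.weight f := by
  induction h with
  | rel p p' h =>
    rcases h with h | h
    · exact hf.weight_stretch h
    · have := hf.weight_rowNear h
      rwa [hf.self h.left_end, hf.self h.left_start, add_zero, zero_add] at this
  | refl p => rfl
  | symm p p' _ ih => exact ih.symm
  | trans p p' p'' _ _ ih ih' => exact ih.trans ih'

/-- The homomorphism on the abelianized discrete fundamental group given by a balanced function. -/
def Balanced.hom (hf : Balanced q f) (σ₀ : Simplex Δ) :
    Additive (Abelianization (DiscreteFundamentalGroup Δ q σ₀)) →+ A :=
  MonoidHom.toAdditiveLeft (Abelianization.lift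
    { toFun := fun x => Multiplicative.ofAdd
        (Quotient.lift (fun p : QChain Δ q σ₀ σ₀ => p.weight f)
          (fun _ _ h => hf.weight_homotopic h) x)
      map_one' := rfl
      map_mul' := fun x y => Quotient.inductionOn₂ x y fun p r =>
        congrArg Multiplicative.ofAdd (weight_append p r) })

end QChain

open QChain

theorem loopClassAb_append {σ₀ : Simplex Δ} (p r : QChain Δ q σ₀ σ₀) :
    loopClassAb (p.append r) = loopClassAb p + loopClassAb r := rfl

theorem loopClassAb_reverse {σ₀ : Simplex Δ} (p : QChain Δ q σ₀ σ₀) :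
    loopClassAb p.reverse = - loopClassAb p := rfl

theorem loopClassAb_eq {σ₀ : Simplex Δ} {p r : QChain Δ q σ₀ σ₀} (h : Homotopic p r) :
    loopClassAb p = loopClassAb r :=
  congrArg (fun x => Additive.ofMul (Abelianization.of x))
    (Quotient.sound (s := loopSetoid Δ q σ₀) h)

theorem exists_loopClassAb {σ₀ : Simplex Δ}
    (x : Additive (Abelianization (DiscreteFundamentalGroup Δ q σ₀))) :
    ∃ p : QChain Δ q σ₀ σ₀, loopClassAb p = x := by
  obtain ⟨y, hy⟩ := QuotientGroup.mk_surjective x.toMul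
  obtain ⟨p, rfl⟩ := Quotient.exists_rep y
  exact ⟨p, hy⟩

namespace QChain

/-- Two ways around a square are homotopic. -/
theorem Homotopic.square {σ τ σ' τ' : Simplex Δ} (h₁ : QNear q σ τ) (h₂ : QNear q σ σ')
    (h₃ : QNear q τ τ') (h₄ : QNear q σ' τ') :
    Homotopic (cons h₁ (cons h₃ (nil τ'))) (cons h₂ (cons h₄ (nil τ'))) := by
  -- After stretching, the rows `σ, τ, τ', τ'` and `σ, σ, σ', τ'` are near position by position.
  have k : QNear q τ' τ' := h₃.symm.left
  refine .trans _ (cons h₁ (cons h₃ (cons k (nil τ')))) _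
    (.rel _ _ (.inl (.there _ (.there _ (.here _ _))))) ?_
  refine .trans _ (cons h₁.left (cons h₂ (cons h₄ (nil τ')))) _ (.rel _ _ (.inr ?_))
    (.symm _ _ (.rel _ _ (.inl (.here _ _))))
  exact .cons _ _ h₁.left (.cons _ _ h₁.symm (.cons _ _ h₄.symm (.nil k)))

theorem Homotopic.append_reverse_append {σ τ υ : Simplex Δ} (p : QChain Δ q σ τ)
    (r : QChain Δ q τ υ) : Homotopic (append p.reverse (append p r)) r := by
  rw [← append_assoc]
  exact (Homotopic.reverse_append p).append_right r

/-- The class of a chain, closed up to a loop by means of fixed chains `γ` from the base simplex. -/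
def basedClass {σ₀ : Simplex Δ} (γ : ∀ σ, QNear q σ σ → QChain Δ q σ₀ σ) {σ τ : Simplex Δ}
    (hσ : QNear q σ σ) (hτ : QNear q τ τ) (r : QChain Δ q σ τ) :
    Additive (Abelianization (DiscreteFundamentalGroup Δ q σ₀)) :=
  loopClassAb (append (γ σ hσ) (append r (γ τ hτ).reverse))

/-- The inner return path `γ τ` is run backwards and then forwards, so it cancels. -/
theorem basedClass_append {σ₀ : Simplex Δ} (γ : ∀ σ, QNear q σ σ → QChain Δ q σ₀ σ)
    {σ τ υ : Simplex Δ} (hσ : QNear q σ σ) (hτ : QNear q τ τ) (hυ : QNear q υ υ)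
    (r : QChain Δ q σ τ) (s : QChain Δ q τ υ) :
    basedClass γ hσ hυ (append r s) = basedClass γ hσ hτ r + basedClass γ hτ hυ s := by
  rw [basedClass, basedClass, basedClass, ← loopClassAb_append]
  refine loopClassAb_eq ?_
  rw [append_assoc, append_assoc, append_assoc]
  exact .symm _ _ (Homotopic.append_left _ (Homotopic.append_left _
    (Homotopic.append_reverse_append _ _)))

theorem basedClass_eq {σ₀ : Simplex Δ} (γ : ∀ σ, QNear q σ σ → QChain Δ q σ₀ σ)
    {σ τ : Simplex Δ} (hσ : QNear q σ σ) (hτ : QNear q τ τ) {r s : QChain Δ q σ τ}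
    (h : Homotopic r s) : basedClass γ hσ hτ r = basedClass γ hσ hτ s :=
  loopClassAb_eq (Homotopic.append_left _ (h.append_right _))

theorem basedClass_nil {σ₀ : Simplex Δ} (γ : ∀ σ, QNear q σ σ → QChain Δ q σ₀ σ) {σ : Simplex Δ}
    (hσ : QNear q σ σ) : basedClass γ hσ hσ (nil σ) = 0 := by
  have := basedClass_append γ hσ hσ hσ (nil σ) (nil σ)
  rwa [append, left_eq_add] at this

open Classical in
/-- The class of a single step. -/
noncomputable def stepClass {σ₀ : Simplex Δ} (γ : ∀ σ, QNear q σ σ → QChain Δ q σ₀ σ)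
    (σ τ : Simplex Δ) : Additive (Abelianization (DiscreteFundamentalGroup Δ q σ₀)) :=
  if h : QNear q σ τ then basedClass γ h.left h.symm.left (cons h (nil τ)) else 0

/-- This is the tautological balanced function: a statement about all balanced functions, applied to
it, becomes a statement about the group. -/
theorem balanced_stepClass {σ₀ : Simplex Δ} (γ : ∀ σ, QNear q σ σ → QChain Δ q σ₀ σ) :
    Balanced q (stepClass γ) := by
  refine ⟨fun σ h => ?_, fun σ τ σ' τ' h₁ h₂ h₃ h₄ => ?_⟩
  · rw [stepClass, dif_pos h, ← basedClass_nil γ h]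
    exact basedClass_eq γ h h (.symm _ _ (.rel _ _ (.inl (.here _ _))))
  · rw [stepClass, stepClass, stepClass, stepClass, dif_pos h₁, dif_pos h₂, dif_pos h₃, dif_pos h₄,
      ← basedClass_append, ← basedClass_append]
    exact basedClass_eq γ _ _ (.square h₁ h₂ h₃ h₄)

theorem basedClass_eq_weight {σ₀ : Simplex Δ} (γ : ∀ σ, QNear q σ σ → QChain Δ q σ₀ σ)
    {σ τ : Simplex Δ} (hσ : QNear q σ σ) (hτ : QNear q τ τ) (r : QChain Δ q σ τ) :
    basedClass γ hσ hτ r = r.weight (stepClass γ) := by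
  induction r with
  | nil => exact basedClass_nil γ hσ
  | cons h p ih =>
    rw [weight, ← ih h.symm.left hτ, stepClass, dif_pos h, ← basedClass_append]
    rfl

/-- Closing up with `γ` conjugates the loop by a fixed loop at `σ₀`, which is invisible after
abelianization. -/
theorem loopClassAb_eq_weight {σ₀ : Simplex Δ} (γ : ∀ σ, QNear q σ σ → QChain Δ q σ₀ σ)
    (h₀ : QNear q σ₀ σ₀) (p : QChain Δ q σ₀ σ₀) : loopClassAb p = p.weight (stepClass γ) := by
  rw [← basedClass_eq_weight γ h₀ h₀, basedClass, loopClassAb_append, loopClassAb_append,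
    loopClassAb_reverse]
  abel

end QChain

end Weight

/-! ### Signed flip numbers and the injectivity of the flip count. -/

namespace Tri

variable {n : ℕ}

theorem exists_superset (σ : Simplex (clusterComplex n)) : ∃ T : Tri n, σ.1 ⊆ T.1.1 := by
  classical
  obtain ⟨S, hS, hm⟩ := Finite.exists_le_maximal
    (p := fun S : Finset (Diagonal n) => S ∈ (clusterComplex n).faces) σ.2
  exact ⟨⟨⟨S, hm.prop⟩, fun τ h => Subtype.ext (hm.eq_of_le τ.2 h).symm⟩, hS⟩

open Classical in
/-- A triangulation that contains a given simplex. -/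
noncomputable def hull (σ : Simplex (clusterComplex n)) : Tri n :=
  if h : IsMaximalSimplex σ then ⟨σ, h⟩ else (exists_superset σ).choose

theorem hull_coe (T : Tri n) : hull T.1 = T := dif_pos T.2

theorem subset_hull (σ : Simplex (clusterComplex n)) : σ.1 ⊆ (hull σ).1.1 := by
  unfold hull
  split_ifs with h
  · exact subset_rfl
  · exact (exists_superset σ).choose_spec

/-- Chains may pass through simplices that are not triangulations; enlarging a simplex to its hull
keeps the shared faces. -/
theorem near_hull {q : ℕ} {σ τ : Simplex (clusterComplex n)} (h : QNear q σ τ) :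
    QNear q σ (hull τ).1 :=
  let ⟨ρ, hc, h₁, h₂⟩ := h
  ⟨ρ, hc, h₁, h₂.trans (subset_hull τ)⟩

theorem hull_near_hull {q : ℕ} {σ τ : Simplex (clusterComplex n)} (h : QNear q σ τ) :
    QNear q (hull σ).1 (hull τ).1 := (near_hull (near_hull h).symm).symm

theorem edge_of_erase_subset {T : Tri n} {S : Finset (Diagonal n)} {u : Diagonal n}
    (h : T.1.1.erase u ⊆ S) {i j : ℕ} (e : T.E i j)
    (hne : ¬ (i = u.1.1.val ∧ j = u.1.2.val)) : Edge S i j := by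
  obtain ⟨h1, h2, h' | h' | ⟨e, he, rfl, rfl⟩⟩ := e
  · exact ⟨h1, h2, .inl h'⟩
  · exact ⟨h1, h2, .inr (.inl h')⟩
  · exact .of_mem (h (Finset.mem_erase.2 ⟨fun h => hne (h ▸ ⟨rfl, rfl⟩), he⟩))

/-- If two neighbouring triangulations contain crossing edges, then every neighbour of the first
contains one of them. -/
theorem edge_or_edge_of_near (hn : 2 ≤ n) {T T' T'' : Tri n} {i j k l : ℕ} (e : T.E i j)
    (e' : T'.E k l) (hc : (i < k ∧ k < j ∧ j < l) ∨ (k < i ∧ i < l ∧ l < j))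
    (h : QNear (n - 2) T.1 T'.1) (h' : QNear (n - 2) T.1 T''.1) : T''.E i j ∨ T''.E k l := by
  by_cases hij : T''.E i j
  · exact .inl hij
  right
  obtain ⟨u, hu, rfl, rfl⟩ : ∃ u ∈ T.1.1, u.1.1.val = i ∧ u.1.2.val = j := by
    obtain ⟨h1, h2, h3 | h3 | h3⟩ := e
    · omega
    · have := e'.2.1; omega
    · exact h3
  have hu' : u ∉ T'.1.1 := fun hu' => by
    have m1 := T'.nc (.of_mem hu') e'
    have m2 := T'.nc e' (.of_mem hu')
    omega
  have hu'' : u ∉ T''.1.1 := fun h => hij (.of_mem h)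
  have s' := erase_subset_of_near hn h hu hu'
  -- `T''` is the flip of `T` at `u`. The sides of the quadrilateral of this flip also lie in `T'`,
  -- and `kl` crosses `u` but none of them, so `kl` is the new diagonal of `T''`.
  obtain ⟨a, b, c, d, ⟨rfl, rfl, H⟩ | ⟨rfl, rfl, H⟩⟩ :=
    up_or_up_of_subset hu hu'' (erase_subset_of_near hn h' hu hu'')
  · have o1 := H.ab.1
    have o2 := H.bc.1
    have o3 := H.cd.1
    have ab := edge_of_erase_subset s' H.ab (by omega)
    have bc := edge_of_erase_subset s' H.bc (by omega)
    have cd := edge_of_erase_subset s' H.cd (by omega)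
    have ad := edge_of_erase_subset s' H.ad (by omega)
    have m1 := T'.nc e' ab
    have m2 := T'.nc ab e'
    have m3 := T'.nc e' bc
    have m4 := T'.nc bc e'
    have m5 := T'.nc e' cd
    have m6 := T'.nc cd e'
    have m7 := T'.nc e' ad
    have m8 := T'.nc ad e'
    obtain rfl : k = a := by omega
    obtain rfl : l = c := by omega
    exact H.edge_new
  · have o1 := H.ab.1
    have o2 := H.bc.1
    have o3 := H.cd.1
    have ab := edge_of_erase_subset s' (H.edge_of_ne H.ab (by omega)) (by omega)
    have bc := edge_of_erase_subset s' (H.edge_of_ne H.bc (by omega)) (by omega)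
    have cd := edge_of_erase_subset s' (H.edge_of_ne H.cd (by omega)) (by omega)
    have ad := edge_of_erase_subset s' (H.edge_of_ne H.ad (by omega)) (by omega)
    have m1 := T'.nc e' ab
    have m2 := T'.nc ab e'
    have m3 := T'.nc e' bc
    have m4 := T'.nc bc e'
    have m5 := T'.nc e' cd
    have m6 := T'.nc cd e'
    have m7 := T'.nc e' ad
    have m8 := T'.nc ad e'
    obtain rfl : k = b := by omega
    obtain rfl : l = d := by omega
    exact H.bd

open Classical in
/-- The indicator of an edge. -/
noncomputable def ind (T : Tri n) (i j : ℕ) : ℤ := if T.E i j then 1 else 0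

theorem ind_of_edge {T : Tri n} {i j : ℕ} (h : T.E i j) : T.ind i j = 1 := if_pos h

theorem ind_of_not_edge {T : Tri n} {i j : ℕ} (h : ¬ T.E i j) : T.ind i j = 0 := if_neg h

theorem ind_ne_zero {T : Tri n} {i j : ℕ} (h : T.ind i j ≠ 0) : T.E i j := by
  by_contra hc
  exact h (if_neg hc)

/-- The signed number of flips of `ce` to `bd`. -/
noncomputable def flipSign (b c d e : ℕ) (T T' : Tri n) : ℤ :=
  T.ind c e * T'.ind b d - T.ind b d * T'.ind c e

theorem ind_add_ind {b c d e : ℕ} (hbc : b < c) (hcd : c < d) (hde : d < e) {T : Tri n}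
    (h : T.E b d ∨ T.E c e) : T.ind b d + T.ind c e = 1 := by
  have key : ¬ (T.E b d ∧ T.E c e) := fun h => T.nc h.1 h.2 ⟨hbc, hcd, hde⟩
  rcases h with h | h
  · rw [ind_of_edge h, ind_of_not_edge fun h' => key ⟨h, h'⟩]; rfl
  · rw [ind_of_edge h, ind_of_not_edge fun h' => key ⟨h', h⟩]; rfl

theorem flipSign_swap (b c d e : ℕ) (T T' : Tri n) :
    flipSign b c d e T' T = - flipSign b c d e T T' := by
  unfold flipSign; ring

theorem ind_add_ind_of_near (hn : 2 ≤ n) {b c d e : ℕ} (hbc : b < c) (hcd : c < d) (hde : d < e)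
    {T T' T'' : Tri n} (h : QNear (n - 2) T.1 T'.1) (h' : QNear (n - 2) T.1 T''.1)
    (hw : flipSign b c d e T T' ≠ 0) : T''.ind b d + T''.ind c e = 1 := by
  apply ind_add_ind hbc hcd hde
  by_cases h1 : T.ind c e * T'.ind b d = 0
  · have h2 : T.ind b d * T'.ind c e ≠ 0 := fun h2 => hw (by rw [flipSign, h1, h2]; rfl)
    exact edge_or_edge_of_near hn (ind_ne_zero (left_ne_zero_of_mul h2))
      (ind_ne_zero (right_ne_zero_of_mul h2)) (.inl ⟨hbc, hcd, hde⟩) h h'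
  · exact (edge_or_edge_of_near hn (ind_ne_zero (left_ne_zero_of_mul h1))
      (ind_ne_zero (right_ne_zero_of_mul h1)) (.inr ⟨hbc, hcd, hde⟩) h h').symm

/-- If a step of a closed walk of length four has nonzero sign, each of the four triangulations is
near an end of that step, so by `ind_add_ind_of_near` it contains exactly one of `bd`, `ce`. Then
every sign in the walk is the difference of the indicators of `bd`, and the sum telescopes.
Otherwise all signs vanish. -/
theorem balanced_flipSign (hn : 2 ≤ n) {b c d e : ℕ} (hbc : b < c) (hcd : c < d) (hde : d < e) :
    QChain.Balanced (Δ := clusterComplex n) (n - 2)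
      (fun σ τ => flipSign b c d e (hull σ) (hull τ)) := by
  refine ⟨fun σ _ => by unfold flipSign; ring, fun σ τ σ' τ' h₁ h₂ h₃ h₄ => ?_⟩
  replace h₁ := hull_near_hull h₁
  replace h₂ := hull_near_hull h₂
  replace h₃ := hull_near_hull h₃
  replace h₄ := hull_near_hull h₄
  generalize hull σ = A at *
  generalize hull τ = B at *
  generalize hull σ' = C at *
  generalize hull τ' = D at *
  have key : ∀ A B C D : Tri n, QNear (n - 2) A.1 B.1 → QNear (n - 2) B.1 C.1 →
      QNear (n - 2) C.1 D.1 → QNear (n - 2) D.1 A.1 → flipSign b c d e A B ≠ 0 →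
      A.ind b d + A.ind c e = 1 ∧ B.ind b d + B.ind c e = 1 ∧ C.ind b d + C.ind c e = 1 ∧
        D.ind b d + D.ind c e = 1 := by
    intro A B C D h1 h2 h3 h4 hw
    have hw' : flipSign b c d e B A ≠ 0 := by
      rw [flipSign_swap]; exact neg_ne_zero.2 hw
    exact ⟨ind_add_ind_of_near hn hbc hcd hde h1 h1.left hw,
      ind_add_ind_of_near hn hbc hcd hde h1 h1 hw,
      ind_add_ind_of_near hn hbc hcd hde h1.symm h2 hw',
      ind_add_ind_of_near hn hbc hcd hde h1 h4.symm hw⟩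
  have fin : A.ind b d + A.ind c e = 1 → B.ind b d + B.ind c e = 1 → C.ind b d + C.ind c e = 1 →
      D.ind b d + D.ind c e = 1 → flipSign b c d e A B + flipSign b c d e B D =
        flipSign b c d e A C + flipSign b c d e C D := by
    intro a1 a2 a3 a4
    unfold flipSign
    rw [eq_sub_of_add_eq' a1, eq_sub_of_add_eq' a2, eq_sub_of_add_eq' a3, eq_sub_of_add_eq' a4]
    ring
  by_cases w1 : flipSign b c d e A B = 0
  · by_cases w2 : flipSign b c d e B D = 0
    · by_cases w3 : flipSign b c d e A C = 0
      · by_cases w4 : flipSign b c d e C D = 0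
        · rw [w1, w2, w3, w4]
        · obtain ⟨a1, a2, a3, a4⟩ := key C D B A h₄ h₃.symm h₁.symm h₂ w4
          exact fin a4 a3 a1 a2
      · obtain ⟨a1, a2, a3, a4⟩ := key A C D B h₂ h₄ h₃.symm h₁.symm w3
        exact fin a1 a4 a2 a3
    · obtain ⟨a1, a2, a3, a4⟩ := key B D C A h₃ h₄.symm h₂.symm h₁ w2
      exact fin a4 a1 a3 a2
  · obtain ⟨a1, a2, a3, a4⟩ := key A B D C h₁ h₃ h₄.symm h₂.symm w1
    exact fin a1 a2 a4 a3

theorem Up.flipSign_self {T T' : Tri n} {a b c d : ℕ} (h : T.Up T' a b c d) :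
    flipSign a b c d T T' = 1 := by
  have : ¬ T.E a c := fun h' => T.nc h' h.bd ⟨h.ab.1, h.bc.1, h.cd.1⟩
  rw [flipSign, ind_of_edge h.bd, ind_of_edge h.edge_new, ind_of_not_edge this]
  ring

/-- A nonzero sign requires crossing edges, one in `T` and one in `T'`. Neither can be common to
both, so they are `bd` and `ac`, which determine the quadrilateral. -/
theorem Up.flipSign_eq_zero {T T' : Tri n} {a b c d p q r s : ℕ} (h : T.Up T' a b c d)
    (hpq : p < q) (hqr : q < r) (hrs : r < s) (hne : ¬ (p = a ∧ q = b ∧ r = c ∧ s = d)) :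
    flipSign p q r s T T' = 0 := by
  have hab := h.ab.1
  have h1 : T.ind q s * T'.ind p r = 0 := by
    by_contra hc
    have e1 := ind_ne_zero (left_ne_zero_of_mul hc)
    have e2 := ind_ne_zero (right_ne_zero_of_mul hc)
    rcases (h.edge_iff _ _).1 e2 with e3 | e3
    · exact T.nc e3.1 e1 ⟨hpq, hqr, hrs⟩
    · by_cases hq : q = b ∧ s = d
      · omega
      · exact T'.nc e2 (h.edge_of_ne e1 hq) ⟨hpq, hqr, hrs⟩
  have h2 : T.ind p r * T'.ind q s = 0 := by
    by_contra hc
    have e1 := ind_ne_zero (left_ne_zero_of_mul hc)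
    have e2 := ind_ne_zero (right_ne_zero_of_mul hc)
    rcases (h.edge_iff _ _).1 e2 with e3 | e3
    · exact T.nc e1 e3.1 ⟨hpq, hqr, hrs⟩
    · by_cases hq : p = b ∧ r = d
      · omega
      · exact T'.nc (h.edge_of_ne e1 hq) e2 ⟨hpq, hqr, hrs⟩
  rw [flipSign, h1, h2]
  rfl

end Tri

/-- Quadrilaterals `b < c < d < e` that avoid the vertex `0`. -/
abbrev Quad (n : ℕ) : Type :=
  {q : Fin (n + 3) × Fin (n + 3) × Fin (n + 3) × Fin (n + 3) //
    0 < q.1.val ∧ q.1.val < q.2.1.val ∧ q.2.1.val < q.2.2.1.val ∧ q.2.2.1.val < q.2.2.2.val}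

namespace Tri

variable {n : ℕ}

/-- The signed number of flips in a given quadrilateral. -/
noncomputable def quadSign (q : Quad n) (T T' : Tri n) : ℤ :=
  flipSign q.1.1.val q.1.2.1.val q.1.2.2.1.val q.1.2.2.2.val T T'

theorem quadSign_swap (q : Quad n) (T T' : Tri n) : quadSign q T' T = - quadSign q T T' :=
  flipSign_swap _ _ _ _ _ _

theorem balanced_quadSign (hn : 2 ≤ n) :
    QChain.Balanced (Δ := clusterComplex n) (n - 2)
      (fun σ τ => fun q : Quad n => quadSign q (hull σ) (hull τ)) :=
  ⟨fun _ h => funext fun q =>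
      (balanced_flipSign hn q.2.2.1 q.2.2.2.1 q.2.2.2.2).self h,
    fun _ _ _ _ h₁ h₂ h₃ h₄ => funext fun q =>
      (balanced_flipSign hn q.2.2.1 q.2.2.2.1 q.2.2.2.2).square h₁ h₂ h₃ h₄⟩

theorem Up.sum_quadSign {A : Type*} [AddCommGroup A] (ψ : ℕ → ℕ → ℕ → ℕ → A) {T T' : Tri n}
    {a b c d : ℕ} (h : T.Up T' a b c d) :
    ∑ q : Quad n, quadSign q T T' • ψ q.1.1.val q.1.2.1.val q.1.2.2.1.val q.1.2.2.2.val =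
      if a = 0 then 0 else ψ a b c d := by
  have oab := h.ab.1
  have obc := h.bc.1
  have ocd := h.cd.1
  have od := h.cd.2.1
  split_ifs with ha
  · refine Finset.sum_eq_zero fun q _ => ?_
    have := q.2.1
    rw [quadSign, h.flipSign_eq_zero q.2.2.1 q.2.2.2.1 q.2.2.2.2 (by omega), zero_smul]
  · let q₀ : Quad n := ⟨(⟨a, by omega⟩, ⟨b, by omega⟩, ⟨c, by omega⟩, ⟨d, by omega⟩),
      by dsimp only; omega⟩
    rw [Finset.sum_eq_single q₀]
    · rw [quadSign, h.flipSign_self, one_smul]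
    · intro q _ hq
      rw [quadSign, h.flipSign_eq_zero q.2.2.1 q.2.2.2.1 q.2.2.2.2, zero_smul]
      rintro ⟨h1, h2, h3, h4⟩
      refine hq (Subtype.ext ?_)
      ext
      exacts [h1, h2, h3, h4]
    · exact fun h => absurd (Finset.mem_univ _) h

/-- Every triangulation can be reached from the fan at the vertex `0`. -/
theorem nonempty_chain_fan (hn : 2 ≤ n) : ∃ F : Tri n, ∀ T : Tri n,
    Nonempty (QChain (clusterComplex n) (n - 2) T.1 F.1) := by
  have hne : (Finset.univ.filter fun d : Diagonal n => d.1.1.val = 0).Nonempty :=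
    Finset.card_pos.1 (by rw [card_first_eq_zero]; omega)
  obtain ⟨d₀, -⟩ := hne
  have base : ∀ T : Tri n, ∃ S : Tri n, (∀ d, d ∈ S.1.1 ↔ d.1.1.val = 0) ∧
      Nonempty (QChain (clusterComplex n) (n - 2) T.1 S.1) := by
    intro T
    induction T using up_induction with
    | _ T ih =>
    rcases T.fan_or_exists_up with h | ⟨T', b, c, d, h⟩
    · exact ⟨T, h, ⟨.nil _⟩⟩
    · obtain ⟨S, hS, ⟨p⟩⟩ := ih _ _ _ _ _ h
      exact ⟨S, hS, ⟨.cons (h.near hn) p⟩⟩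
  obtain ⟨F, hF, -⟩ := base (hull ⟨{d₀}, (clusterComplex n).singleton_mem d₀⟩)
  refine ⟨F, fun T => ?_⟩
  obtain ⟨S, hS, hp⟩ := base T
  have : S = F := Subtype.ext (Subtype.ext (Finset.ext fun d => (hS d).trans (hF d).symm))
  exact this ▸ hp

theorem nonempty_chain (hn : 2 ≤ n) (T : Tri n) {σ : Simplex (clusterComplex n)}
    (h : QNear (n - 2) σ σ) : Nonempty (QChain (clusterComplex n) (n - 2) T.1 σ) := by
  obtain ⟨F, hF⟩ := nonempty_chain_fan hn
  obtain ⟨p⟩ := hF T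
  obtain ⟨r⟩ := hF (hull σ)
  exact ⟨p.append (r.reverse.append (.cons (near_hull h).symm (.nil σ)))⟩

/-- The homomorphism that counts signed flips in the quadrilaterals avoiding the vertex `0`. -/
noncomputable def flipCount (hn : 2 ≤ n) (T₀ : Simplex (clusterComplex n)) :
    ClusterGroupAb n T₀ →+ (Quad n → ℤ) :=
  (balanced_quadSign hn).hom T₀

/-- By `Flat.exists_eq` the tautological function `stepClass` is a coboundary plus a linear function
of the signed flip numbers. Along a loop the coboundary telescopes, so a loop without net flips has
trivial class. -/
theorem flipCount_injective (hn : 2 ≤ n) (T₀ : Tri n) :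
    Function.Injective (flipCount hn T₀.1) := by
  rw [injective_iff_map_eq_zero]
  intro x hx
  obtain ⟨p, rfl⟩ := exists_loopClassAb x
  have γ : ∀ σ, QNear (n - 2) σ σ → QChain (clusterComplex n) (n - 2) T₀.1 σ :=
    fun σ h => (nonempty_chain hn T₀ h).some
  have hE := QChain.balanced_stepClass γ
  obtain ⟨h, ψ, hψ⟩ := Flat.exists_eq (f := fun T T' : Tri n => QChain.stepClass γ T.1 T'.1)
    fun _ _ _ _ _ _ _ _ _ _ _ _ h1 h2 h3 h4 =>
      hE.square (h1.near hn) (h2.near hn) (h3.near hn) (h4.near hn)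
  have step : ∀ T T' : Tri n, QNear (n - 2) T.1 T'.1 → QChain.stepClass γ T.1 T'.1 = h T - h T' +
      ∑ q : Quad n, quadSign q T T' • ψ q.1.1.val q.1.2.1.val q.1.2.2.1.val q.1.2.2.2.val := by
    intro T T' hT
    by_cases hTT : T = T'
    · subst hTT
      rw [hE.self hT, sub_self, zero_add, Finset.sum_eq_zero]
      intro q _
      rw [quadSign, flipSign, mul_comm, sub_self, zero_smul]
    · obtain ⟨a, b, c, d, h' | h'⟩ := up_or_up_of_near hn hT hTT
      · rw [h'.sum_quadSign]
        exact hψ h'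
      · simp only [quadSign_swap _ T' T, neg_smul, Finset.sum_neg_distrib]
        rw [h'.sum_quadSign, eq_neg_of_add_eq_zero_left (hE.add_swap hT),
          show QChain.stepClass γ T'.1 T.1 = _ from hψ h']
        abel
  -- The end terms `stepClass γ σ (hull σ)` account for simplices that are not triangulations; each
  -- step is compared with the step between the hulls by a square.
  have chain : ∀ {σ τ : Simplex (clusterComplex n)} (r : QChain (clusterComplex n) (n - 2) σ τ),
      r.weight (QChain.stepClass γ) =
        (h (hull σ) + QChain.stepClass γ σ (hull σ).1) -
        (h (hull τ) + QChain.stepClass γ τ (hull τ).1) +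
        ∑ q : Quad n, r.weight
          (fun σ τ => fun q : Quad n => quadSign q (hull σ) (hull τ)) q •
            ψ q.1.1.val q.1.2.1.val q.1.2.2.1.val q.1.2.2.2.val := by
    intro σ τ r
    induction r with
    | nil => simp [QChain.weight]
    | cons k p ih =>
      simp only [QChain.weight, Pi.add_apply, add_smul, Finset.sum_add_distrib, ih]
      have e := hE.square k (near_hull k.left) (near_hull k.symm.left) (hull_near_hull k)
      rw [step _ _ (hull_near_hull k)] at e
      rw [eq_sub_of_add_eq e]
      abel
  have h0 : p.weight (fun σ τ => fun q : Quad n => quadSign q (hull σ) (hull τ)) = 0 := hx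
  rw [QChain.loopClassAb_eq_weight γ (T₀.near_refl hn) p, chain, h0]
  simp

end Tri

/-! ### Pentagons and the triangulations that refine a dissection with one pentagon. -/

/-- The segment `ij` crosses the segment `kl`. -/
def Cr (i j k l : ℕ) : Prop := (i < k ∧ k < j ∧ j < l) ∨ (k < i ∧ i < l ∧ l < j)

/-- The region with vertices `a < b < c < d < e` of the dissection by `S` is a pentagon. -/
structure Pent {n : ℕ} (S : Finset (Diagonal n)) (a b c d e : ℕ) : Prop where
  ab : Edge S a b
  bc : Edge S b c
  cd : Edge S c d
  de : Edge S d e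
  ae : Edge S a e
  nac : ¬ Edge S a c
  nbd : ¬ Edge S b d
  nce : ¬ Edge S c e
  nad : ¬ Edge S a d
  nbe : ¬ Edge S b e

/-- The diagonals `δ 0, …, δ 4` are those of the pentagon `abcde`, in such an order that cyclically
consecutive ones do not cross. -/
structure PentDiag {n : ℕ} (δ : Fin 5 → Diagonal n) (a b c d e : ℕ) : Prop where
  l0 : (δ 0).1.1.val = a
  r0 : (δ 0).1.2.val = c
  l1 : (δ 1).1.1.val = a
  r1 : (δ 1).1.2.val = d
  l2 : (δ 2).1.1.val = b
  r2 : (δ 2).1.2.val = d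
  l3 : (δ 3).1.1.val = b
  r3 : (δ 3).1.2.val = e
  l4 : (δ 4).1.1.val = c
  r4 : (δ 4).1.2.val = e

/-- A segment that crosses no side lies inside the closed pentagon or outside it. The case split on
the position of `i` only keeps the arithmetic goals small. -/
theorem pentagon_trichotomy {a b c d e i j : ℕ} (hab : a < b) (hbc : b < c) (hcd : c < d)
    (hde : d < e) (hij : i < j) (h1 : ¬ Cr i j a b) (h2 : ¬ Cr i j b c) (h3 : ¬ Cr i j c d)
    (h4 : ¬ Cr i j d e) (h5 : ¬ Cr i j a e) :
    ((i = a ∧ j = c) ∨ (i = a ∧ j = d) ∨ (i = b ∧ j = d) ∨ (i = b ∧ j = e) ∨ (i = c ∧ j = e)) ∨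
      (¬ Cr i j a c ∧ ¬ Cr i j a d ∧ ¬ Cr i j b d ∧ ¬ Cr i j b e ∧ ¬ Cr i j c e) := by
  unfold Cr at *
  rcases lt_or_ge i a with hi | hi
  · right; omega
  rcases lt_or_ge e j with hj | hj
  · right; omega
  have hI : i = a ∨ i = b ∨ i = c ∨ (a < i ∧ i < b ∧ j ≤ b) ∨ (b < i ∧ i < c ∧ j ≤ c) ∨
      (c < i ∧ i < d ∧ j ≤ d) ∨ d ≤ i := by omega
  rcases hI with rfl | rfl | rfl | h | h | h | h
  · have hJ : j ≤ b ∨ j = c ∨ j = d ∨ j = e := by omega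
    omega
  · have hJ : j ≤ c ∨ j = d ∨ j = e := by omega
    omega
  · have hJ : j ≤ d ∨ j = e := by omega
    omega
  all_goals right; omega

/-- Two noncrossing diagonals of a pentagon cross or exhaust all its diagonals. -/
theorem pentagon_not_diagonal {a b c d e p q r s : ℕ} (hab : a < b) (hbc : b < c) (hcd : c < d)
    (hde : d < e)
    (h : (p = a ∧ q = c) ∨ (p = a ∧ q = d) ∨ (p = b ∧ q = d) ∨ (p = b ∧ q = e) ∨ (p = c ∧ q = e))
    (h' : (r = a ∧ s = c) ∨ (r = a ∧ s = d) ∨ (r = b ∧ s = d) ∨ (r = b ∧ s = e) ∨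
      (r = c ∧ s = e))
    (hne : ¬ (p = r ∧ q = s)) (hc : ¬ Cr p q r s) {i j : ℕ}
    (hn : ¬ (i = p ∧ j = q) ∧ ¬ (i = r ∧ j = s) ∧ ¬ Cr i j p q ∧ ¬ Cr i j r s) :
    ¬ ((i = a ∧ j = c) ∨ (i = a ∧ j = d) ∨ (i = b ∧ j = d) ∨ (i = b ∧ j = e) ∨
      (i = c ∧ j = e)) := by
  unfold Cr at *
  rcases h with ⟨rfl, rfl⟩ | ⟨rfl, rfl⟩ | ⟨rfl, rfl⟩ | ⟨rfl, rfl⟩ | ⟨rfl, rfl⟩ <;>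
  rcases h' with ⟨rfl, rfl⟩ | ⟨rfl, rfl⟩ | ⟨rfl, rfl⟩ | ⟨rfl, rfl⟩ | ⟨rfl, rfl⟩ <;>
  first
  | (exfalso; clear hn; omega)
  | (rintro (⟨rfl, rfl⟩ | ⟨rfl, rfl⟩ | ⟨rfl, rfl⟩ | ⟨rfl, rfl⟩ | ⟨rfl, rfl⟩) <;>
      clear hne hc <;> omega)

section

variable {n : ℕ}

theorem Edge.not_cr {S : Finset (Diagonal n)} (hS : ∀ d ∈ S, ∀ e ∈ S, ¬ Crosses d e)
    {i j k l : ℕ} (h : Edge S i j) (h' : Edge S k l) : ¬ Cr i j k l := by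
  rintro (hc | hc)
  · exact h.noncross hS h' hc
  · exact h'.noncross hS h hc

theorem isPentagonRegion_iff {S : Finset (Diagonal n)} {L : Finset (Fin (n + 3))} :
    IsPentagonRegion S L ↔ ∃ a b c d e : Fin (n + 3), a < b ∧ b < c ∧ c < d ∧ d < e ∧
      L = {a, b, c, d, e} ∧ Pent S a.val b.val c.val d.val e.val := by
  unfold IsPentagonRegion
  refine exists_congr fun a => exists_congr fun b => exists_congr fun c => exists_congr fun d =>
    exists_congr fun e => and_congr_right fun h1 => and_congr_right fun h2 =>
    and_congr_right fun h3 => and_congr_right fun h4 => and_congr_right fun _ => ?_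
  rw [isEdgeOf_iff h1, isEdgeOf_iff h2, isEdgeOf_iff h3, isEdgeOf_iff h4,
    isEdgeOf_iff (h1.trans (h2.trans (h3.trans h4))), isEdgeOf_iff (h1.trans h2),
    isEdgeOf_iff (h2.trans h3), isEdgeOf_iff (h3.trans h4), isEdgeOf_iff (h1.trans (h2.trans h3)),
    isEdgeOf_iff (h2.trans (h3.trans h4))]
  constructor
  · rintro ⟨⟨k1, k2, k3, k4, k5⟩, k6, k7, k8, k9, k10⟩
    exact ⟨k1, k2, k3, k4, k5, k6, k7, k8, k9, k10⟩
  · rintro ⟨k1, k2, k3, k4, k5, k6, k7, k8, k9, k10⟩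
    exact ⟨⟨k1, k2, k3, k4, k5⟩, k6, k7, k8, k9, k10⟩

theorem forall_fin_five {p : Fin 5 → Prop} : (∀ k, p k) ↔ p 0 ∧ p 1 ∧ p 2 ∧ p 3 ∧ p 4 := by
  refine ⟨fun h => ⟨h 0, h 1, h 2, h 3, h 4⟩, fun ⟨h0, h1, h2, h3, h4⟩ k => ?_⟩
  fin_cases k
  exacts [h0, h1, h2, h3, h4]

theorem exists_pentDiag {a b c d e : ℕ} (hab : a < b) (hbc : b < c) (hcd : c < d) (hde : d < e)
    (he : e ≤ n + 2) : ∃ δ : Fin 5 → Diagonal n, PentDiag δ a b c d e :=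
  ⟨![mkDiagonal a c (by omega) (by omega) (by omega), mkDiagonal a d (by omega) (by omega)
      (by omega), mkDiagonal b d (by omega) (by omega) (by omega), mkDiagonal b e (by omega)
      (by omega) (by omega), mkDiagonal c e (by omega) (by omega) (by omega)],
    rfl, rfl, rfl, rfl, rfl, rfl, rfl, rfl, rfl, rfl⟩

theorem Tri.exists_of_card {S : Finset (Diagonal n)} (hne : S.Nonempty)
    (hS : ∀ d ∈ S, ∀ e ∈ S, ¬ Crosses d e) (hc : S.card = n) : ∃ T : Tri n, T.1.1 = S :=
  ⟨_, (Finset.eq_of_subset_of_card_le (subset_hull ⟨S, hne, hS⟩)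
    (by rw [Tri.card_eq]; exact hc.ge)).symm⟩

namespace PentDiag

variable {δ : Fin 5 → Diagonal n} {a b c d e : ℕ}

theorem injective (hδ : PentDiag δ a b c d e) (hab : a < b) (hbc : b < c) (hcd : c < d)
    (hde : d < e) : Function.Injective δ := by
  obtain ⟨l0, r0, l1, r1, l2, r2, l3, r3, l4, r4⟩ := hδ
  have key : ∀ j k, (δ j).1.1.val = (δ k).1.1.val → (δ j).1.2.val = (δ k).1.2.val → j = k := by
    simp only [forall_fin_five, l0, l1, l2, l3, l4, r0, r1, r2, r3, r4]
    refine ⟨⟨?_, ?_, ?_, ?_, ?_⟩, ⟨?_, ?_, ?_, ?_, ?_⟩, ⟨?_, ?_, ?_, ?_, ?_⟩,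
      ⟨?_, ?_, ?_, ?_, ?_⟩, ⟨?_, ?_, ?_, ?_, ?_⟩⟩ <;> intro h1 h2 <;> first | rfl | omega
  exact fun j k h => key j k (by rw [h]) (by rw [h])

theorem not_crosses (hδ : PentDiag δ a b c d e) (hab : a < b) (hbc : b < c) (hcd : c < d)
    (hde : d < e) (k : Fin 5) : ¬ Crosses (δ k) (δ (k + 1)) := by
  obtain ⟨l0, r0, l1, r1, l2, r2, l3, r3, l4, r4⟩ := hδ
  revert k
  rw [forall_fin_five]
  simp only [crosses_iff, show (0 : Fin 5) + 1 = 1 from rfl, show (1 : Fin 5) + 1 = 2 from rfl,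
    show (2 : Fin 5) + 1 = 3 from rfl, show (3 : Fin 5) + 1 = 4 from rfl,
    show (4 : Fin 5) + 1 = 0 from rfl, l0, l1, l2, l3, l4, r0, r1, r2, r3, r4]
  omega

theorem exists_eq (hδ : PentDiag δ a b c d e) {u : Diagonal n}
    (hu : (u.1.1.val = a ∧ u.1.2.val = c) ∨ (u.1.1.val = a ∧ u.1.2.val = d) ∨
      (u.1.1.val = b ∧ u.1.2.val = d) ∨ (u.1.1.val = b ∧ u.1.2.val = e) ∨
      (u.1.1.val = c ∧ u.1.2.val = e)) : ∃ k, u = δ k := by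
  obtain ⟨l0, r0, l1, r1, l2, r2, l3, r3, l4, r4⟩ := hδ
  rcases hu with h | h | h | h | h
  · exact ⟨0, Diagonal.ext_val (by omega) (by omega)⟩
  · exact ⟨1, Diagonal.ext_val (by omega) (by omega)⟩
  · exact ⟨2, Diagonal.ext_val (by omega) (by omega)⟩
  · exact ⟨3, Diagonal.ext_val (by omega) (by omega)⟩
  · exact ⟨4, Diagonal.ext_val (by omega) (by omega)⟩

/-- In the order of `PentDiag` the noncrossing pairs form a 5-cycle; this is the combinatorial form
of the flip pentagon. -/
theorem eq_or_eq_of_not_crosses (hδ : PentDiag δ a b c d e) (hab : a < b) (hbc : b < c)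
    (hcd : c < d) (hde : d < e) (j k : Fin 5) (hjk : j ≠ k) (h : ¬ Crosses (δ j) (δ k)) :
    k = j + 1 ∨ j = k + 1 := by
  obtain ⟨l0, r0, l1, r1, l2, r2, l3, r3, l4, r4⟩ := hδ
  have key : ∀ j k : Fin 5, k = j ∨ k = j + 1 ∨ j = k + 1 ∨ Crosses (δ j) (δ k) := by
    simp only [forall_fin_five, crosses_iff, l0, l1, l2, l3, l4, r0, r1, r2, r3, r4]
    refine ⟨⟨?_, ?_, ?_, ?_, ?_⟩, ⟨?_, ?_, ?_, ?_, ?_⟩, ⟨?_, ?_, ?_, ?_, ?_⟩,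
      ⟨?_, ?_, ?_, ?_, ?_⟩, ⟨?_, ?_, ?_, ?_, ?_⟩⟩ <;>
      first
        | exact .inl trivial
        | exact .inr (.inl rfl)
        | exact .inr (.inr (.inl rfl))
        | exact .inr (.inr (.inr (by omega)))
  rcases key j k with h' | h' | h' | h'
  · exact absurd h'.symm hjk
  · exact .inl h'
  · exact .inr h'
  · exact absurd h' h

end PentDiag

namespace Pent

variable {S : Finset (Diagonal n)} {a b c d e : ℕ} {δ : Fin 5 → Diagonal n}

theorem notMem (h : Pent S a b c d e) (hδ : PentDiag δ a b c d e) (k : Fin 5) : δ k ∉ S := by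
  obtain ⟨l0, r0, l1, r1, l2, r2, l3, r3, l4, r4⟩ := hδ
  revert k
  rw [forall_fin_five]
  refine ⟨fun hm => ?_, fun hm => ?_, fun hm => ?_, fun hm => ?_, fun hm => ?_⟩ <;>
    replace hm := Edge.of_mem hm
  · exact h.nac (by rwa [l0, r0] at hm)
  · exact h.nad (by rwa [l1, r1] at hm)
  · exact h.nbd (by rwa [l2, r2] at hm)
  · exact h.nbe (by rwa [l3, r3] at hm)
  · exact h.nce (by rwa [l4, r4] at hm)

/-- A diagonal that does not cross the sides of the pentagon is a diagonal of the pentagon or does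
not cross any of these. -/
theorem exists_eq_or (h : Pent S a b c d e) (hδ : PentDiag δ a b c d e) {u : Diagonal n}
    (hu : ∀ {i j}, Edge S i j → ¬ Cr u.1.1.val u.1.2.val i j) :
    (∃ k, u = δ k) ∨ ∀ k, ¬ Crosses u (δ k) := by
  rcases pentagon_trichotomy h.ab.1 h.bc.1 h.cd.1 h.de.1 (by have := u.2.1; omega) (hu h.ab)
    (hu h.bc) (hu h.cd) (hu h.de) (hu h.ae) with h' | h'
  · exact .inl (hδ.exists_eq h')
  · obtain ⟨l0, r0, l1, r1, l2, r2, l3, r3, l4, r4⟩ := hδ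
    right
    simp only [forall_fin_five, crosses_iff, l0, l1, l2, l3, l4, r0, r1, r2, r3, r4]
    exact ⟨h'.1, h'.2.1, h'.2.2.1, h'.2.2.2.1, h'.2.2.2.2⟩

theorem not_crosses (h : Pent S a b c d e) (hδ : PentDiag δ a b c d e)
    (hS : ∀ d ∈ S, ∀ e ∈ S, ¬ Crosses d e) {u : Diagonal n} (hu : u ∈ S) (k : Fin 5) :
    ¬ Crosses u (δ k) := by
  rcases h.exists_eq_or hδ fun e => Edge.not_cr hS (.of_mem hu) e with ⟨j, rfl⟩ | h'
  · exact absurd hu (h.notMem hδ j)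
  · exact h' k

theorem insert_noncrossing (h : Pent S a b c d e) (hδ : PentDiag δ a b c d e)
    (hS : ∀ d ∈ S, ∀ e ∈ S, ¬ Crosses d e) (k : Fin 5) :
    ∀ x ∈ insert (δ k) (insert (δ (k + 1)) S), ∀ y ∈ insert (δ k) (insert (δ (k + 1)) S),
      ¬ Crosses x y := by
  have h0 : ∀ x : Diagonal n, ¬ Crosses x x := by
    rintro x (⟨h, -⟩ | ⟨h, -⟩) <;> exact lt_irrefl _ h
  have h1 := hδ.not_crosses h.ab.1 h.bc.1 h.cd.1 h.de.1 k
  have h2 : ¬ Crosses (δ (k + 1)) (δ k) := fun h => h1 h.symm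
  have h3 := fun {u} (hu : u ∈ S) k => h.not_crosses hδ hS hu k
  have h4 : ∀ {u}, u ∈ S → ∀ k, ¬ Crosses (δ k) u := fun hu k hc => h3 hu k hc.symm
  intro x hx y hy
  simp only [Finset.mem_insert] at hx hy
  rcases hx with rfl | rfl | hx <;> rcases hy with rfl | rfl | hy
  exacts [h0 _, h1, h4 hy _, h2, h0 _, h4 hy _, h3 hx _, h3 hx _, hS _ hx _ hy]

theorem card_insert (h : Pent S a b c d e) (hδ : PentDiag δ a b c d e) (hc : S.card + 2 = n)
    (k : Fin 5) : (insert (δ k) (insert (δ (k + 1)) S)).card = n := by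
  rw [Finset.card_insert_of_notMem, Finset.card_insert_of_notMem (h.notMem hδ _)]
  · exact hc
  rw [Finset.mem_insert, not_or]
  refine ⟨fun hk => ?_, h.notMem hδ _⟩
  have hne : ∀ k : Fin 5, k ≠ k + 1 := by decide
  exact hne k (hδ.injective h.ab.1 h.bc.1 h.cd.1 h.de.1 hk)

theorem exists_tri (h : Pent S a b c d e) (hδ : PentDiag δ a b c d e)
    (hS : ∀ d ∈ S, ∀ e ∈ S, ¬ Crosses d e) (hc : S.card + 2 = n) (k : Fin 5) :
    ∃ T : Tri n, T.1.1 = insert (δ k) (insert (δ (k + 1)) S) :=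
  Tri.exists_of_card (Finset.insert_nonempty _ _) (h.insert_noncrossing hδ hS k)
    (h.card_insert hδ hc k)

/-- Otherwise `u` crosses neither `S` nor any diagonal of the pentagon, so it belongs to the
triangulation obtained from `S` by adding `δ 0` and `δ 1`, which forces it into `S` or among these
two. -/
theorem exists_eq_of_notMem (h : Pent S a b c d e) (hδ : PentDiag δ a b c d e)
    (hS : ∀ d ∈ S, ∀ e ∈ S, ¬ Crosses d e) (hc : S.card + 2 = n) {T : Tri n} (hT : S ⊆ T.1.1)
    {u : Diagonal n} (hu : u ∈ T.1.1) (huS : u ∉ S) : ∃ k, u = δ k := by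
  rcases h.exists_eq_or hδ fun e => Edge.not_cr T.1.2.2 (.of_mem hu) (e.mono hT) with h' | h'
  · exact h'
  · obtain ⟨T', hT'⟩ := h.exists_tri hδ hS hc 0
    have : u ∈ T'.1.1 := by
      refine T'.mem_of_noncross u fun v hv => ?_
      rw [hT'] at hv
      simp only [Finset.mem_insert] at hv
      rcases hv with rfl | rfl | hv
      exacts [h' _, h' _, T.1.2.2 u hu v (hT hv)]
    rw [hT'] at this
    simp only [Finset.mem_insert] at this
    rcases this with h | h | h
    exacts [⟨_, h⟩, ⟨_, h⟩, absurd h huS]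

/-- The triangulations that refine a dissection with a single pentagon are obtained by adding two
diagonals of the pentagon. -/
theorem exists_eq_insert (h : Pent S a b c d e) (hδ : PentDiag δ a b c d e)
    (hS : ∀ d ∈ S, ∀ e ∈ S, ¬ Crosses d e) (hc : S.card + 2 = n) {T : Tri n} (hT : S ⊆ T.1.1) :
    ∃ k, T.1.1 = insert (δ k) (insert (δ (k + 1)) S) := by
  have h2 : (T.1.1 \ S).card = 2 := by
    rw [Finset.card_sdiff_of_subset hT, T.card_eq]; omega
  obtain ⟨x, y, hxy, hTS⟩ := Finset.card_eq_two.1 h2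
  have hx : x ∈ T.1.1 \ S := by rw [hTS]; exact Finset.mem_insert_self _ _
  have hy : y ∈ T.1.1 \ S := by
    rw [hTS]; exact Finset.mem_insert_of_mem (Finset.mem_singleton_self _)
  rw [Finset.mem_sdiff] at hx hy
  obtain ⟨j, rfl⟩ := h.exists_eq_of_notMem hδ hS hc hT hx.1 hx.2
  obtain ⟨k, rfl⟩ := h.exists_eq_of_notMem hδ hS hc hT hy.1 hy.2
  have key : ∀ j, δ j ∈ T.1.1 → δ (j + 1) ∈ T.1.1 →
      T.1.1 = insert (δ j) (insert (δ (j + 1)) S) := by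
    intro j h1 h2
    refine (Finset.eq_of_subset_of_card_le ?_ ?_).symm
    · exact Finset.insert_subset h1 (Finset.insert_subset h2 hT)
    · rw [T.card_eq, h.card_insert hδ hc]
  rcases hδ.eq_or_eq_of_not_crosses h.ab.1 h.bc.1 h.cd.1 h.de.1 j k (fun h => hxy (h ▸ rfl))
    (T.1.2.2 _ hx.1 _ hy.1) with rfl | rfl
  · exact ⟨j, key j hx.1 hy.1⟩
  · exact ⟨k, key k hy.1 hx.1⟩

/-- A dissection with two diagonals less than a triangulation has at most one pentagon. -/
theorem unique (h : Pent S a b c d e) {a' b' c' d' e' : ℕ} (h' : Pent S a' b' c' d' e')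
    (hS : ∀ d ∈ S, ∀ e ∈ S, ¬ Crosses d e) (hc : S.card + 2 = n) :
    a = a' ∧ b = b' ∧ c = c' ∧ d = d' ∧ e = e' := by
  obtain ⟨δ, hδ⟩ := exists_pentDiag (n := n) h.ab.1 h.bc.1 h.cd.1 h.de.1 h.de.2.1
  obtain ⟨δ', hδ'⟩ := exists_pentDiag (n := n) h'.ab.1 h'.bc.1 h'.cd.1 h'.de.1 h'.de.2.1
  -- Each diagonal of the second pentagon extends `S` to a triangulation, so it is a diagonal of the
  -- first one. Four of these five coincidences already determine all vertices.
  have key : ∀ j, ∃ k, δ' j = δ k := by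
    intro j
    obtain ⟨T, hT⟩ := h'.exists_tri hδ' hS hc j
    have hST : S ⊆ T.1.1 := by
      rw [hT]
      exact (Finset.subset_insert _ _).trans (Finset.subset_insert _ _)
    exact h.exists_eq_of_notMem hδ hS hc hST (hT ▸ Finset.mem_insert_self _ _) (h'.notMem hδ' j)
  have key' : ∀ j, ∃ k, (δ' j).1.1.val = (δ k).1.1.val ∧ (δ' j).1.2.val = (δ k).1.2.val :=
    fun j => (key j).imp fun k hk => ⟨by rw [hk], by rw [hk]⟩
  obtain ⟨l0, r0, l1, r1, l2, r2, l3, r3, l4, r4⟩ := hδ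
  obtain ⟨l0', r0', l1', r1', l2', r2', l3', r3', l4', r4'⟩ := hδ'
  have ex : ∀ {p : Fin 5 → Prop}, (∃ k, p k) → p 0 ∨ p 1 ∨ p 2 ∨ p 3 ∨ p 4 := by
    rintro p ⟨k, hk⟩
    revert hk
    revert k
    rw [forall_fin_five]
    tauto
  have k0 := ex (key' 0)
  have k1 := ex (key' 1)
  have k2 := ex (key' 2)
  have k3 := ex (key' 3)
  simp only [l0, r0, l1, r1, l2, r2, l3, r3, l4, r4, l0', r0', l1', r1', l2', r2', l3', r3']
    at k0 k1 k2 k3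
  have := h.ab.1
  have := h.bc.1
  have := h.cd.1
  have := h.de.1
  have := h'.ab.1
  have := h'.bc.1
  have := h'.cd.1
  have := h'.de.1
  clear key key' ex l0 r0 l1 r1 l2 r2 l3 r3 l4 r4 l0' r0' l1' r1' l2' r2' l3' r3' l4' r4'
  omega

/-- If a triangulation has exactly two diagonals that are not in `S`, and these are diagonals of a
pentagon whose sides are edges of the triangulation, then the pentagon is a region of the dissection
by `S`. -/
theorem of_tri {T : Tri n} (hST : S ⊆ T.1.1) {x y : Diagonal n} (hx : x ∈ T.1.1) (hxS : x ∉ S)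
    (hy : y ∈ T.1.1) (hyS : y ∉ S) (hxy : x ≠ y) (hrest : ∀ u ∈ T.1.1, u ≠ x → u ≠ y → u ∈ S)
    (ab : T.E a b) (bc : T.E b c) (cd : T.E c d) (de : T.E d e) (ae : T.E a e)
    (hx' : (x.1.1.val = a ∧ x.1.2.val = c) ∨ (x.1.1.val = a ∧ x.1.2.val = d) ∨
      (x.1.1.val = b ∧ x.1.2.val = d) ∨ (x.1.1.val = b ∧ x.1.2.val = e) ∨
      (x.1.1.val = c ∧ x.1.2.val = e))
    (hy' : (y.1.1.val = a ∧ y.1.2.val = c) ∨ (y.1.1.val = a ∧ y.1.2.val = d) ∨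
      (y.1.1.val = b ∧ y.1.2.val = d) ∨ (y.1.1.val = b ∧ y.1.2.val = e) ∨
      (y.1.1.val = c ∧ y.1.2.val = e)) : Pent S a b c d e := by
  have o1 := ab.1
  have o2 := bc.1
  have o3 := cd.1
  have o4 := de.1
  have hE : ∀ {i j}, T.E i j → ¬ (i = x.1.1.val ∧ j = x.1.2.val) →
      ¬ (i = y.1.1.val ∧ j = y.1.2.val) → Edge S i j := by
    rintro i j ⟨h1, h2, h' | h' | ⟨u, hu, rfl, rfl⟩⟩ n1 n2
    · exact ⟨h1, h2, .inl h'⟩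
    · exact ⟨h1, h2, .inr (.inl h')⟩
    · exact .of_mem (hrest u hu (fun h => n1 (h ▸ ⟨rfl, rfl⟩)) fun h => n2 (h ▸ ⟨rfl, rfl⟩))
  have hxy' : ¬ (x.1.1.val = y.1.1.val ∧ x.1.2.val = y.1.2.val) := fun h =>
    hxy (Diagonal.ext_val h.1 h.2)
  have hcr : ¬ Cr x.1.1.val x.1.2.val y.1.1.val y.1.2.val := T.1.2.2 x hx y hy
  have hN : ∀ {i j}, Edge S i j → ¬ (i = x.1.1.val ∧ j = x.1.2.val) ∧
      ¬ (i = y.1.1.val ∧ j = y.1.2.val) ∧ ¬ Cr i j x.1.1.val x.1.2.val ∧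
      ¬ Cr i j y.1.1.val y.1.2.val := fun h =>
    ⟨fun hh => hxS (Edge.mem (by rwa [hh.1, hh.2] at h)),
      fun hh => hyS (Edge.mem (by rwa [hh.1, hh.2] at h)),
      Edge.not_cr T.1.2.2 (h.mono hST) (.of_mem hx), Edge.not_cr T.1.2.2 (h.mono hST) (.of_mem hy)⟩
  clear hST hx hxS hy hyS hxy hrest
  have hD : ∀ {i j}, Edge S i j → _ := fun h =>
    pentagon_not_diagonal o1 o2 o3 o4 hx' hy' hxy' hcr (hN h)
  refine ⟨hE ab ?_ ?_, hE bc ?_ ?_, hE cd ?_ ?_, hE de ?_ ?_, hE ae ?_ ?_,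
    fun h => hD h (.inl ⟨rfl, rfl⟩), fun h => hD h (.inr (.inr (.inl ⟨rfl, rfl⟩))),
    fun h => hD h (.inr (.inr (.inr (.inr ⟨rfl, rfl⟩)))), fun h => hD h (.inr (.inl ⟨rfl, rfl⟩)),
    fun h => hD h (.inr (.inr (.inr (.inl ⟨rfl, rfl⟩))))⟩ <;>
    clear hE hN hD hcr hxy' ab bc cd de ae <;> omega

end Pent

/-- Every diagonal of a triangulation is a diagonal of a quadrilateral. -/
theorem Tri.exists_quadrilateral (T : Tri n) {u : Diagonal n} (hu : u ∈ T.1.1) :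
    ∃ a b c d, T.E a b ∧ T.E b c ∧ T.E c d ∧ T.E a d ∧ ∃ v : Diagonal n,
      ((u.1.1.val = b ∧ u.1.2.val = d ∧ v.1.1.val = a ∧ v.1.2.val = c) ∨
        (u.1.1.val = a ∧ u.1.2.val = c ∧ v.1.1.val = b ∧ v.1.2.val = d)) := by
  have e := Edge.of_mem hu
  have h2 := u.2.1
  obtain ⟨z, hz1, hz2, e1, e2⟩ := T.inner_apex e (by omega)
  rcases T.outer_apex e u.2.2 with ⟨w, hw, e3, e4⟩ | ⟨w, hw, e3, e4⟩
  · exact ⟨w, _, z, _, e3, e1, e2, e4, mkDiagonal w z (by omega) (by have := e2.2.1; omega)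
      (by have := e2.2.1; omega), .inl ⟨rfl, rfl, rfl, rfl⟩⟩
  · exact ⟨_, z, _, w, e1, e2, e4, e3, mkDiagonal z w (by omega) e4.2.1 (by omega),
      .inr ⟨rfl, rfl, rfl, rfl⟩⟩

end

section

variable {n : ℕ}

/-- When `y` is a side of the quadrilateral around `x`, the two missing diagonals share a triangle,
and the apex on the far side of `y` is the fifth vertex of the pentagon. -/
theorem Pent.exists_of_side {S : Finset (Diagonal n)} {T : Tri n} (hST : S ⊆ T.1.1)
    {x y : Diagonal n} (hx : x ∈ T.1.1) (hxS : x ∉ S) (hy : y ∈ T.1.1) (hyS : y ∉ S) (hxy : x ≠ y)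
    (hrest : ∀ u ∈ T.1.1, u ≠ x → u ≠ y → u ∈ S) {a b c d : ℕ}
    (ab : T.E a b) (bc : T.E b c) (cd : T.E c d) (ad : T.E a d)
    (hx' : (x.1.1.val = b ∧ x.1.2.val = d) ∨ (x.1.1.val = a ∧ x.1.2.val = c))
    (hy' : (y.1.1.val = a ∧ y.1.2.val = b) ∨ (y.1.1.val = b ∧ y.1.2.val = c) ∨
      (y.1.1.val = c ∧ y.1.2.val = d) ∨ (y.1.1.val = a ∧ y.1.2.val = d)) :
    ∃ p q r s t, Pent S p q r s t := by
  have hy2 := y.2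
  have key : ∀ {p q r s t}, T.E p q → T.E q r → T.E r s → T.E s t → T.E p t → _ → _ → _ :=
    fun {p q r s t} h1 h2 h3 h4 h5 h6 h7 => (⟨p, q, r, s, t, Pent.of_tri hST hx hxS hy hyS hxy
      hrest h1 h2 h3 h4 h5 h6 h7⟩ : ∃ p q r s t, Pent S p q r s t)
  rcases hy' with h | h | h | h
  · obtain ⟨z, -, -, e1, e2⟩ := T.inner_apex ab (by omega)
    exact key e1 e2 bc cd ad
      (hx'.elim (fun h => .inr (.inr (.inr (.inr h)))) fun h => .inr (.inl h)) (.inl h)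
  · obtain ⟨z, -, -, e1, e2⟩ := T.inner_apex bc (by omega)
    exact key ab e1 e2 cd ad
      (hx'.elim (fun h => .inr (.inr (.inr (.inl h)))) fun h => .inr (.inl h))
      (.inr (.inr (.inl h)))
  · obtain ⟨z, -, -, e1, e2⟩ := T.inner_apex cd (by omega)
    exact key ab bc e1 e2 ad (hx'.elim (fun h => .inr (.inr (.inr (.inl h)))) fun h => .inl h)
      (.inr (.inr (.inr (.inr h))))
  · rcases T.outer_apex ad (by omega) with ⟨z, -, e1, e2⟩ | ⟨z, -, e1, e2⟩
    · exact key e1 ab bc cd e2 (hx'.elim (fun h => .inr (.inr (.inr (.inr h)))) fun h =>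
        .inr (.inr (.inl h))) (.inr (.inr (.inr (.inl h))))
    · exact key ab bc cd e2 e1 (hx'.elim (fun h => .inr (.inr (.inl h))) fun h => .inl h)
        (.inr (.inl h))

/-- By maximality some diagonal of `T` crosses `u`; since it crosses no side of the quadrilateral,
it is `v`. -/
theorem Tri.mem_of_notMem_quadrilateral (T : Tri n) {a b c d : ℕ} {u v : Diagonal n}
    (ab : T.E a b) (bc : T.E b c) (cd : T.E c d) (ad : T.E a d)
    (h : (u.1.1.val = b ∧ u.1.2.val = d ∧ v.1.1.val = a ∧ v.1.2.val = c) ∨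
        (u.1.1.val = a ∧ u.1.2.val = c ∧ v.1.1.val = b ∧ v.1.2.val = d))
    (hu : u ∉ T.1.1) : v ∈ T.1.1 := by
  have hcross : ∃ w ∈ T.1.1, Crosses u w := by
    by_contra! hc
    exact hu (T.mem_of_noncross u hc)
  obtain ⟨w, hw, hc⟩ := hcross
  have ew := Edge.of_mem hw
  have o1 := ab.1
  have o2 := bc.1
  have o3 := cd.1
  have m1 := T.nc ew ab
  have m2 := T.nc ab ew
  have m3 := T.nc ew bc
  have m4 := T.nc bc ew
  have m5 := T.nc ew cd
  have m6 := T.nc cd ew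
  have m7 := T.nc ew ad
  have m8 := T.nc ad ew
  rw [crosses_iff] at hc
  have : v.1.1.val = w.1.1.val ∧ v.1.2.val = w.1.2.val := by
    rcases h with ⟨h1, h2, h3, h4⟩ | ⟨h1, h2, h3, h4⟩ <;> rw [h1, h2] at hc <;> rw [h3, h4] <;>
      rcases hc with hc | hc <;> omega
  exact Diagonal.ext_val this.1 this.2 ▸ hw

theorem Tri.eq_of_mem {S : Finset (Diagonal n)} (hc : S.card + 2 = n) {T T' : Tri n}
    (h : S ⊆ T.1.1) (h' : S ⊆ T'.1.1) {x y : Diagonal n} (hxy : x ≠ y) (hx : x ∉ S) (hy : y ∉ S)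
    (hxT : x ∈ T.1.1) (hyT : y ∈ T.1.1) (hxT' : x ∈ T'.1.1) (hyT' : y ∈ T'.1.1) : T = T' := by
  have key : ∀ {T : Tri n}, S ⊆ T.1.1 → x ∈ T.1.1 → y ∈ T.1.1 →
      insert x (insert y S) = T.1.1 := by
    intro T h hxT hyT
    refine Finset.eq_of_subset_of_card_le
      (Finset.insert_subset hxT (Finset.insert_subset hyT h)) ?_
    rw [T.card_eq, Finset.card_insert_of_notMem, Finset.card_insert_of_notMem hy]
    · exact hc.ge
    · rw [Finset.mem_insert, not_or]
      exact ⟨hxy, hx⟩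
  exact Subtype.ext (Subtype.ext ((key h hxT hyT).symm.trans (key h' hxT' hyT')))

/-! ### Labels of geodesic 5-cycles. -/

namespace GeodesicFiveCycle

/-- The nodes of a geodesic 5-cycle as triangulations. -/
def tri (C : GeodesicFiveCycle n) (i : Fin 5) : Tri n := ⟨C.node i, C.isMaximal_node i⟩

theorem core_noncrossing (C : GeodesicFiveCycle n) : ∀ d ∈ C.core, ∀ e ∈ C.core, ¬ Crosses d e :=
  fun d hd e he => (C.node 0).2.2 d (C.core_subset 0 hd) e (C.core_subset 0 he)

theorem tri_injective (C : GeodesicFiveCycle n) : Function.Injective C.tri :=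
  fun _ _ h => C.node_injective (congrArg Subtype.val h)

/-- Node `0` has two diagonals `x`, `y` outside the core. If their quadrilaterals share a triangle,
the core leaves a pentagon. If not, `x` and `y` can only be exchanged independently for `v` and `w`,
which gives four triangulations and contradicts the five distinct nodes. -/
theorem exists_pent (C : GeodesicFiveCycle n) : ∃ a b c d e, Pent C.core a b c d e := by
  have hST : C.core ⊆ (C.tri 0).1.1 := C.core_subset 0
  have h2 : ((C.tri 0).1.1 \ C.core).card = 2 := by
    rw [Finset.card_sdiff_of_subset hST, (C.tri 0).card_eq]
    have := C.card_core
    omega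
  obtain ⟨x, y, hxy, hTS⟩ := Finset.card_eq_two.1 h2
  have hx : x ∈ (C.tri 0).1.1 \ C.core := by rw [hTS]; exact Finset.mem_insert_self _ _
  have hy : y ∈ (C.tri 0).1.1 \ C.core := by
    rw [hTS]; exact Finset.mem_insert_of_mem (Finset.mem_singleton_self _)
  have hrest : ∀ u ∈ (C.tri 0).1.1, u ≠ x → u ≠ y → u ∈ C.core := by
    intro u hu h1 h2
    by_contra hc
    have : u ∈ (C.tri 0).1.1 \ C.core := Finset.mem_sdiff.2 ⟨hu, hc⟩
    rw [hTS, Finset.mem_insert, Finset.mem_singleton] at this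
    exact this.elim h1 h2
  rw [Finset.mem_sdiff] at hx hy
  obtain ⟨hx, hxS⟩ := hx
  obtain ⟨hy, hyS⟩ := hy
  obtain ⟨a, b, c, d, ab, bc, cd, ad, v, hv⟩ := (C.tri 0).exists_quadrilateral hx
  obtain ⟨p, q, r, s, pq, qr, rs, ps, w, hw⟩ := (C.tri 0).exists_quadrilateral hy
  by_cases hy' : (y.1.1.val = a ∧ y.1.2.val = b) ∨ (y.1.1.val = b ∧ y.1.2.val = c) ∨
      (y.1.1.val = c ∧ y.1.2.val = d) ∨ (y.1.1.val = a ∧ y.1.2.val = d)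
  · exact Pent.exists_of_side hST hx hxS hy hyS hxy hrest ab bc cd ad
      (hv.imp (fun h => ⟨h.1, h.2.1⟩) fun h => ⟨h.1, h.2.1⟩) hy'
  by_cases hx' : (x.1.1.val = p ∧ x.1.2.val = q) ∨ (x.1.1.val = q ∧ x.1.2.val = r) ∨
      (x.1.1.val = r ∧ x.1.2.val = s) ∨ (x.1.1.val = p ∧ x.1.2.val = s)
  · exact Pent.exists_of_side hST hy hyS hx hxS hxy.symm (fun u hu h1 h2 => hrest u hu h2 h1)
      pq qr rs ps (hw.imp (fun h => ⟨h.1, h.2.1⟩) fun h => ⟨h.1, h.2.1⟩) hx'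
  exfalso
  have o1 := ab.1
  have o2 := bc.1
  have o3 := cd.1
  have o4 := pq.1
  have o5 := qr.1
  have o6 := rs.1
  have ex := Edge.of_mem hx
  have ey := Edge.of_mem hy
  have hE : ∀ {i j}, (C.tri 0).E i j → ¬ (i = x.1.1.val ∧ j = x.1.2.val) →
      ¬ (i = y.1.1.val ∧ j = y.1.2.val) → ∀ k, (C.tri k).E i j := by
    rintro i j ⟨h1, h2, h' | h' | ⟨u, hu, rfl, rfl⟩⟩ n1 n2 k
    · exact ⟨h1, h2, .inl h'⟩
    · exact ⟨h1, h2, .inr (.inl h')⟩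
    · exact .of_mem (C.core_subset k
        (hrest u hu (fun h => n1 (h ▸ ⟨rfl, rfl⟩)) fun h => n2 (h ▸ ⟨rfl, rfl⟩)))
  have sx : ¬ (a = x.1.1.val ∧ b = x.1.2.val) ∧ ¬ (b = x.1.1.val ∧ c = x.1.2.val) ∧
      ¬ (c = x.1.1.val ∧ d = x.1.2.val) ∧ ¬ (a = x.1.1.val ∧ d = x.1.2.val) := by
    clear hE hrest hx' hy' hw
    omega
  have sy : ¬ (p = y.1.1.val ∧ q = y.1.2.val) ∧ ¬ (q = y.1.1.val ∧ r = y.1.2.val) ∧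
      ¬ (r = y.1.1.val ∧ s = y.1.2.val) ∧ ¬ (p = y.1.1.val ∧ s = y.1.2.val) := by
    clear hE hrest hx' hy' hv sx
    omega
  push Not at hx' hy'
  have hxv : ∀ k, x ∉ (C.tri k).1.1 → v ∈ (C.tri k).1.1 := fun k =>
    (C.tri k).mem_of_notMem_quadrilateral
      (hE ab sx.1 (fun h => hy'.1 h.1.symm h.2.symm) k)
      (hE bc sx.2.1 (fun h => hy'.2.1 h.1.symm h.2.symm) k)
      (hE cd sx.2.2.1 (fun h => hy'.2.2.1 h.1.symm h.2.symm) k)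
      (hE ad sx.2.2.2 (fun h => hy'.2.2.2 h.1.symm h.2.symm) k) hv
  have hyw : ∀ k, y ∉ (C.tri k).1.1 → w ∈ (C.tri k).1.1 := fun k =>
    (C.tri k).mem_of_notMem_quadrilateral
      (hE pq (fun h => hx'.1 h.1.symm h.2.symm) sy.1 k)
      (hE qr (fun h => hx'.2.1 h.1.symm h.2.symm) sy.2.1 k)
      (hE rs (fun h => hx'.2.2.1 h.1.symm h.2.symm) sy.2.2.1 k)
      (hE ps (fun h => hx'.2.2.2 h.1.symm h.2.symm) sy.2.2.2 k) hw
  clear hE hx' hy' sx sy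
  have hvT : v ∉ (C.tri 0).1.1 := fun h => by
    have m1 := (C.tri 0).nc (.of_mem h) ex
    have m2 := (C.tri 0).nc ex (.of_mem h)
    clear hw
    omega
  have hwT : w ∉ (C.tri 0).1.1 := fun h => by
    have m1 := (C.tri 0).nc (.of_mem h) ey
    have m2 := (C.tri 0).nc ey (.of_mem h)
    clear hv
    omega
  have hvw : v ≠ w := by
    rintro rfl
    have hne : ¬ (x.1.1.val = y.1.1.val ∧ x.1.2.val = y.1.2.val) := fun h =>
      hxy (Diagonal.ext_val h.1 h.2)
    have m1 := (C.tri 0).nc ey ab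
    have m2 := (C.tri 0).nc ab ey
    have m3 := (C.tri 0).nc ey bc
    have m4 := (C.tri 0).nc bc ey
    have m5 := (C.tri 0).nc ey cd
    have m6 := (C.tri 0).nc cd ey
    have m7 := (C.tri 0).nc ey ad
    have m8 := (C.tri 0).nc ad ey
    clear hxv hyw ex ey hrest
    rcases hv with hv | hv <;> rcases hw with hw | hw <;> omega
  have hvS : v ∉ C.core := fun h => hvT (hST h)
  have hwS : w ∉ C.core := fun h => hwT (hST h)
  have hxw : x ≠ w := fun h => hwT (h ▸ hx)
  have hvy : v ≠ y := fun h => hvT (h ▸ hy)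
  -- A node is determined by whether it contains `x` and whether it contains `y`, so five nodes
  -- would inject into four values.
  have inj : Function.Injective fun i : Fin 5 =>
      (decide (x ∈ (C.tri i).1.1), decide (y ∈ (C.tri i).1.1)) := by
    intro i j hij
    simp only [Prod.mk.injEq, decide_eq_decide] at hij
    have hSi : C.core ⊆ (C.tri i).1.1 := C.core_subset i
    have hSj : C.core ⊆ (C.tri j).1.1 := C.core_subset j
    apply C.tri_injective
    by_cases h1 : x ∈ (C.tri i).1.1
    · have h1' := hij.1.1 h1
      by_cases h2 : y ∈ (C.tri i).1.1
      · exact Tri.eq_of_mem C.card_core hSi hSj hxy hxS hyS h1 h2 h1' (hij.2.1 h2)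
      · exact Tri.eq_of_mem C.card_core hSi hSj hxw hxS hwS h1 (hyw i h2) h1'
          (hyw j (mt hij.2.2 h2))
    · have h1' := hxv j (mt hij.1.2 h1)
      by_cases h2 : y ∈ (C.tri i).1.1
      · exact Tri.eq_of_mem C.card_core hSi hSj hvy hvS hyS (hxv i h1) h2 h1' (hij.2.1 h2)
      · exact Tri.eq_of_mem C.card_core hSi hSj hvw hvS hwS (hxv i h1) (hyw i h2) h1'
          (hyw j (mt hij.2.2 h2))
  have := Fintype.card_le_of_injective _ inj
  simp at this

theorem existsUnique_label (C : GeodesicFiveCycle n) : ∃! L, C.HasLabel L := by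
  obtain ⟨a, b, c, d, e, h⟩ := C.exists_pent
  have o1 := h.ab.1
  have o2 := h.bc.1
  have o3 := h.cd.1
  have o4 := h.de.1
  have o5 := h.de.2.1
  refine ⟨_, isPentagonRegion_iff.2 ⟨⟨a, by omega⟩, ⟨b, by omega⟩, ⟨c, by omega⟩, ⟨d, by omega⟩,
    ⟨e, by omega⟩, o1, o2, o3, o4, rfl, h⟩, fun L hL => ?_⟩
  obtain ⟨a', b', c', d', e', -, -, -, -, rfl, h'⟩ := isPentagonRegion_iff.1 hL
  obtain ⟨rfl, rfl, rfl, rfl, rfl⟩ := h.unique h' C.core_noncrossing C.card_core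
  rfl

end GeodesicFiveCycle

theorem card_of_lt {m : ℕ} {a b c d e : Fin m} (h1 : a < b) (h2 : b < c) (h3 : c < d)
    (h4 : d < e) : ({a, b, c, d, e} : Finset (Fin m)).card = 5 := by
  repeat rw [Finset.card_insert_of_notMem]
  · rfl
  all_goals
    simp only [Finset.mem_insert, Finset.mem_singleton, Fin.ext_iff]
    omega

theorem exists_sorted {m : ℕ} {L : Finset (Fin m)} (h : L.card = 5) :
    ∃ a b c d e, a < b ∧ b < c ∧ c < d ∧ d < e ∧ L = {a, b, c, d, e} := by
  have hm := (L.orderEmbOfFin h).strictMono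
  refine ⟨L.orderEmbOfFin h 0, L.orderEmbOfFin h 1, L.orderEmbOfFin h 2, L.orderEmbOfFin h 3,
    L.orderEmbOfFin h 4, hm (by decide), hm (by decide), hm (by decide), hm (by decide), ?_⟩
  ext x
  have : x ∈ L ↔ ∃ i, L.orderEmbOfFin h i = x := by
    rw [← Set.mem_range, Finset.range_orderEmbOfFin, Finset.mem_coe]
  rw [this]
  simp only [Finset.mem_insert, Finset.mem_singleton]
  constructor
  · rintro ⟨i, rfl⟩
    fin_cases i <;> simp
  · rintro (rfl | rfl | rfl | rfl | rfl) <;> exact ⟨_, rfl⟩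

theorem sorted_unique {m : ℕ} {a b c d e a' b' c' d' e' : Fin m} (h1 : a < b) (h2 : b < c)
    (h3 : c < d) (h4 : d < e) (h1' : a' < b') (h2' : b' < c') (h3' : c' < d') (h4' : d' < e')
    (h : ({a, b, c, d, e} : Finset (Fin m)) = {a', b', c', d', e'}) :
    a = a' ∧ b = b' ∧ c = c' ∧ d = d' ∧ e = e' := by
  have hm : ∀ x, x = a ∨ x = b ∨ x = c ∨ x = d ∨ x = e → x = a' ∨ x = b' ∨ x = c' ∨ x = d' ∨
      x = e' := fun x hx => by
    have : x ∈ ({a, b, c, d, e} : Finset (Fin m)) := by simpa using hx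
    rw [h] at this
    simpa using this
  have ha := hm a (by simp)
  have hb := hm b (by simp)
  have hc := hm c (by simp)
  have hd := hm d (by simp)
  have he := hm e (by simp)
  simp only [Fin.ext_iff, Fin.lt_def] at *
  clear h hm
  omega

theorem GeodesicFiveCycle.card_label (C : GeodesicFiveCycle n) {L : Finset (Fin (n + 3))}
    (h : C.HasLabel L) : L.card = 5 := by
  obtain ⟨a, b, c, d, e, h1, h2, h3, h4, rfl, -⟩ := h
  exact card_of_lt h1 h2 h3 h4

/-- Every pentagon is a region of a dissection into triangles and this pentagon. -/
theorem exists_dissection {a b c d e : ℕ} (hab : a < b) (hbc : b < c) (hcd : c < d) (hde : d < e)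
    (he : e ≤ n + 2) : ∃ S : Finset (Diagonal n), (∀ d ∈ S, ∀ e ∈ S, ¬ Crosses d e) ∧
      S.card + 2 = n ∧ Pent S a b c d e := by
  classical
  -- The sides of the pentagon together with `ac` and `ad` are noncrossing; a triangulation
  -- containing those that are diagonals, with `ac` and `ad` removed, is the required dissection.
  let p : Diagonal n → Prop := fun u =>
    (u.1.1.val = a ∧ u.1.2.val = b) ∨ (u.1.1.val = b ∧ u.1.2.val = c) ∨
    (u.1.1.val = c ∧ u.1.2.val = d) ∨ (u.1.1.val = d ∧ u.1.2.val = e) ∨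
    (u.1.1.val = a ∧ u.1.2.val = e) ∨ (u.1.1.val = a ∧ u.1.2.val = c) ∨
    (u.1.1.val = a ∧ u.1.2.val = d)
  obtain ⟨x, hx1, hx2⟩ : ∃ x : Diagonal n, x.1.1.val = a ∧ x.1.2.val = c :=
    ⟨mkDiagonal a c (by omega) (by omega) (by omega), rfl, rfl⟩
  obtain ⟨y, hy1, hy2⟩ : ∃ y : Diagonal n, y.1.1.val = a ∧ y.1.2.val = d :=
    ⟨mkDiagonal a d (by omega) (by omega) (by omega), rfl, rfl⟩
  have hR : Finset.univ.filter p ∈ (clusterComplex n).faces := by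
    refine ⟨⟨x, Finset.mem_filter.2 ⟨Finset.mem_univ _, by simp only [p]; omega⟩⟩,
      fun u hu v hv => ?_⟩
    simp only [Finset.mem_filter, Finset.mem_univ, true_and, p] at hu hv
    rw [crosses_iff]
    rcases hu with hu | hu | hu | hu | hu | hu | hu <;> omega
  obtain ⟨T, hT⟩ := Tri.exists_superset ⟨_, hR⟩
  have hmem : ∀ u, p u → u ∈ T.1.1 := fun u hu =>
    hT (Finset.mem_filter.2 ⟨Finset.mem_univ _, hu⟩)
  have hxT := hmem x (by simp only [p]; omega)
  have hyT := hmem y (by simp only [p]; omega)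
  have hxy : y ≠ x := fun h => by rw [h] at hy2; omega
  have hedge : ∀ {i j}, i < j → j ≤ n + 2 →
      (∀ u : Diagonal n, u.1.1.val = i → u.1.2.val = j → p u) → T.E i j := by
    intro i j hij hj h
    by_cases h1 : j = i + 1
    · exact ⟨hij, hj, .inl h1⟩
    by_cases h2 : i = 0 ∧ j = n + 2
    · exact ⟨hij, hj, .inr (.inl h2)⟩
    exact Edge.of_mem (hmem (mkDiagonal i j (by omega) hj h2) (h _ rfl rfl))
  have hcard := T.card_eq
  rw [← Finset.card_erase_add_one hxT,
    ← Finset.card_erase_add_one (Finset.mem_erase.2 ⟨hxy, hyT⟩)] at hcard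
  refine ⟨(T.1.1.erase x).erase y, fun u hu v hv => ?_, hcard, ?_⟩
  · exact T.1.2.2 u (Finset.mem_of_mem_erase (Finset.mem_of_mem_erase hu)) v
      (Finset.mem_of_mem_erase (Finset.mem_of_mem_erase hv))
  · refine Pent.of_tri (T := T) (x := x) (y := y)
      ((Finset.erase_subset _ _).trans (Finset.erase_subset _ _)) hxT (by simp) hyT (by simp)
      hxy.symm (fun u hu h1 h2 => Finset.mem_erase.2 ⟨h2, Finset.mem_erase.2 ⟨h1, hu⟩⟩)
      (hedge hab (by omega) fun u h1 h2 => ?_) (hedge hbc (by omega) fun u h1 h2 => ?_)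
      (hedge hcd (by omega) fun u h1 h2 => ?_) (hedge hde (by omega) fun u h1 h2 => ?_)
      (hedge (by omega) (by omega) fun u h1 h2 => ?_) (by omega) (by omega) <;>
      simp only [p] <;> omega

/-- The nodes are `S` with `δ k` and `δ (k + 1)` added; consecutive ones share `S` with `δ (k + 1)`,
which has `n - 1` diagonals. -/
theorem exists_cycle {a b c d e : ℕ} (hab : a < b) (hbc : b < c) (hcd : c < d) (hde : d < e)
    (he : e ≤ n + 2) : ∃ C : GeodesicFiveCycle n, Pent C.core a b c d e := by
  obtain ⟨S, hS, hc, h⟩ := exists_dissection hab hbc hcd hde he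
  obtain ⟨δ, hδ⟩ := exists_pentDiag (n := n) hab hbc hcd hde he
  have hinj := hδ.injective hab hbc hcd hde
  choose T hT using h.exists_tri hδ hS hc
  have near : ∀ k, QNear (n - 2) (T k).1 (T (k + 1)).1 := by
    intro k
    have hsub : insert (δ (k + 1)) S ⊆ (T k).1.1 := by
      rw [hT]; exact Finset.subset_insert _ _
    have hsub' : insert (δ (k + 1)) S ⊆ (T (k + 1)).1.1 := by
      rw [hT]; exact Finset.insert_subset_insert _ (Finset.subset_insert _ _)
    refine ⟨⟨insert (δ (k + 1)) S, Finset.insert_nonempty _ _, fun x hx y hy =>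
      (T k).1.2.2 x (hsub hx) y (hsub hy)⟩, ?_, hsub, hsub'⟩
    rw [Finset.card_insert_of_notMem (h.notMem hδ _)]
    omega
  refine ⟨⟨S, hc, fun k => (T k).1, ?_, fun k => (T k).2, fun k => ?_, near⟩, h⟩
  · intro j k hjk
    have hjk : (T j).1.1 = (T k).1.1 := congrArg Subtype.val hjk
    rw [hT, hT] at hjk
    have key : ∀ {j k : Fin 5}, δ j ∈ insert (δ k) (insert (δ (k + 1)) S) → j = k ∨ j = k + 1 := by
      intro j k hj
      simp only [Finset.mem_insert] at hj
      rcases hj with hj | hj | hj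
      exacts [.inl (hinj hj), .inr (hinj hj), absurd hj (h.notMem hδ j)]
    have h1 : j = k ∨ j = k + 1 := key (hjk ▸ Finset.mem_insert_self _ _)
    have h2 : k = j ∨ k = j + 1 := key (hjk ▸ Finset.mem_insert_self _ _)
    have fin : ∀ j k : Fin 5, (j = k ∨ j = k + 1) → (k = j ∨ k = j + 1) → j = k := by decide
    exact fin j k h1 h2
  · rw [hT]
    exact (Finset.subset_insert _ _).trans (Finset.subset_insert _ _)

/-- An injective closed walk on a 5-cycle cannot turn back, so it keeps its direction. -/
theorem fin_five_direction {s : Fin 5 → Fin 5} (hs : Function.Injective s)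
    (h : ∀ i, s (i + 1) = s i + 1 ∨ s i = s (i + 1) + 1) :
    (∀ i, s (i + 1) = s i + 1) ∨ ∀ i, s i = s (i + 1) + 1 := by
  have key : ∀ x y z : Fin 5, (y = x + 1 ∨ x = y + 1) → (z = y + 1 ∨ y = z + 1) → x ≠ z →
      (y = x + 1 → z = y + 1) ∧ (x = y + 1 → y = z + 1) := by decide
  have step : ∀ i, (s (i + 1) = s i + 1 → s (i + 1 + 1) = s (i + 1) + 1) ∧
      (s i = s (i + 1) + 1 → s (i + 1) = s (i + 1 + 1) + 1) := fun i =>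
    key _ _ _ (h i) (h (i + 1)) fun hh => by
      have h2 : ∀ i : Fin 5, i ≠ i + 1 + 1 := by decide
      exact h2 i (hs hh)
  simp only [forall_fin_five]
  rcases h 0 with h0 | h0
  · have h1 := (step 0).1 h0
    have h2 := (step 1).1 h1
    have h3 := (step 2).1 h2
    have h4 := (step 3).1 h3
    exact .inl ⟨h0, h1, h2, h3, h4⟩
  · have h1 := (step 0).2 h0
    have h2 := (step 1).2 h1
    have h3 := (step 2).2 h2
    have h4 := (step 3).2 h3
    exact .inr ⟨h0, h1, h2, h3, h4⟩

/-! ### The flip numbers of a geodesic 5-cycle. -/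

open Classical in
/-- The indicator of the pair `δ k`, `δ (k + 1)`. -/
noncomputable def pairInd (δ : Fin 5 → Diagonal n) (k : Fin 5) (i j : ℕ) : ℤ :=
  if ((δ k).1.1.val = i ∧ (δ k).1.2.val = j) ∨ ((δ (k + 1)).1.1.val = i ∧ (δ (k + 1)).1.2.val = j)
    then 1 else 0

/-- The signed numbers of flips along the pentagon with diagonals `δ`. -/
noncomputable def pentVector (δ : Fin 5 → Diagonal n) (q : Quad n) : ℤ :=
  ∑ k, (pairInd δ k q.1.2.1.val q.1.2.2.2.val * pairInd δ (k + 1) q.1.1.val q.1.2.2.1.val -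
    pairInd δ k q.1.1.val q.1.2.2.1.val * pairInd δ (k + 1) q.1.2.1.val q.1.2.2.2.val)

theorem Tri.ind_eq_pairInd {S : Finset (Diagonal n)} {δ : Fin 5 → Diagonal n} {k : Fin 5}
    {T : Tri n} (hT : T.1.1 = insert (δ k) (insert (δ (k + 1)) S)) {i j : ℕ} :
    (¬ Edge S i j → T.ind i j = pairInd δ k i j) ∧ (¬ T.E i j → pairInd δ k i j = 0) := by
  have h1 : ∀ u ∈ T.1.1, u.1.1.val = i → u.1.2.val = j → T.E i j := by
    rintro u hu rfl rfl
    exact .of_mem hu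
  have h2 : ((δ k).1.1.val = i ∧ (δ k).1.2.val = j) ∨
      ((δ (k + 1)).1.1.val = i ∧ (δ (k + 1)).1.2.val = j) → T.E i j := by
    rintro (h | h)
    · exact h1 (δ k) (by rw [hT]; simp) h.1 h.2
    · exact h1 (δ (k + 1)) (by rw [hT]; simp) h.1 h.2
  refine ⟨fun hS => ?_, fun hE => if_neg (mt h2 hE)⟩
  by_cases hE : T.E i j
  · rw [ind_of_edge hE, pairInd, if_pos]
    obtain ⟨hij, hj, h | h | ⟨u, hu, rfl, rfl⟩⟩ := hE
    · exact absurd ⟨hij, hj, .inl h⟩ hS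
    · exact absurd ⟨hij, hj, .inr (.inl h)⟩ hS
    · rw [hT] at hu
      simp only [Finset.mem_insert] at hu
      rcases hu with rfl | rfl | hu
      · exact .inl ⟨rfl, rfl⟩
      · exact .inr ⟨rfl, rfl⟩
      · exact absurd (.of_mem hu) hS
  · rw [ind_of_not_edge hE, pairInd, if_neg (mt h2 hE)]

/-- This eliminates `S`. If `bd` or `ce` is an edge of the core dissection, neither triangulation
contains the other one and both sides vanish; otherwise only the added pentagon diagonals matter. -/
theorem Tri.quadSign_eq {S : Finset (Diagonal n)} {δ : Fin 5 → Diagonal n} {k l : Fin 5}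
    {T T' : Tri n} (hT : T.1.1 = insert (δ k) (insert (δ (k + 1)) S))
    (hT' : T'.1.1 = insert (δ l) (insert (δ (l + 1)) S)) (q : Quad n) :
    quadSign q T T' =
      pairInd δ k q.1.2.1.val q.1.2.2.2.val * pairInd δ l q.1.1.val q.1.2.2.1.val -
      pairInd δ k q.1.1.val q.1.2.2.1.val * pairInd δ l q.1.2.1.val q.1.2.2.2.val := by
  obtain ⟨⟨⟨b, hb⟩, ⟨c, hc⟩, ⟨d, hd⟩, ⟨e, he⟩⟩, h0, hbc, hcd, hde⟩ := q
  dsimp only at *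
  unfold quadSign flipSign
  have sub : ∀ {k} {T : Tri n}, T.1.1 = insert (δ k) (insert (δ (k + 1)) S) → S ⊆ T.1.1 := by
    intro k T hT
    rw [hT]
    exact (Finset.subset_insert _ _).trans (Finset.subset_insert _ _)
  by_cases hbd : Edge S b d
  · have n1 : ¬ T.E c e := fun h => T.nc (hbd.mono (sub hT)) h ⟨hbc, hcd, hde⟩
    have n2 : ¬ T'.E c e := fun h => T'.nc (hbd.mono (sub hT')) h ⟨hbc, hcd, hde⟩
    rw [ind_of_not_edge n1, ind_of_not_edge n2, (ind_eq_pairInd hT).2 n1, (ind_eq_pairInd hT').2 n2]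
    ring
  by_cases hce : Edge S c e
  · have n1 : ¬ T.E b d := fun h => T.nc h (hce.mono (sub hT)) ⟨hbc, hcd, hde⟩
    have n2 : ¬ T'.E b d := fun h => T'.nc h (hce.mono (sub hT')) ⟨hbc, hcd, hde⟩
    rw [ind_of_not_edge n1, ind_of_not_edge n2, (ind_eq_pairInd hT).2 n1, (ind_eq_pairInd hT').2 n2]
    ring
  rw [(ind_eq_pairInd hT).1 hbd, (ind_eq_pairInd hT).1 hce, (ind_eq_pairInd hT').1 hbd,
    (ind_eq_pairInd hT').1 hce]

/-- The way to the cycle and the way back cancel. As `p` does not occur in the result, injectivity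
of `flipCount` makes the class independent of `p`. -/
theorem Tri.flipCount_classVia (hn : 2 ≤ n) {T₀ : Simplex (clusterComplex n)}
    (C : GeodesicFiveCycle n) (p : QChain (clusterComplex n) (n - 2) T₀ (C.node 0)) :
    flipCount hn T₀ (C.classVia p) = fun q => ∑ i, quadSign q (C.tri i) (C.tri (i + 1)) := by
  have h : flipCount hn T₀ (C.classVia p) =
      ((p.append C.loop).append p.reverse).weight
        (fun σ τ => fun q : Quad n => quadSign q (hull σ) (hull τ)) := rfl
  have hh : ∀ i, hull (C.node i) = C.tri i := fun i => hull_coe (C.tri i)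
  rw [h, QChain.weight_append, QChain.weight_append, (balanced_quadSign hn).weight_reverse]
  funext q
  simp only [GeodesicFiveCycle.loop, QChain.weight, Pi.add_apply, Pi.neg_apply, Pi.zero_apply, hh,
    Fin.sum_univ_five]
  simp only [show (0 : Fin 5) + 1 = 1 from rfl, show (1 : Fin 5) + 1 = 2 from rfl,
    show (2 : Fin 5) + 1 = 3 from rfl, show (3 : Fin 5) + 1 = 4 from rfl,
    show (4 : Fin 5) + 1 = 0 from rfl]
  ring

/-- The signed flip numbers of a geodesic 5-cycle depend only on its label and its direction. -/
theorem Tri.flipCount_eq_or (hn : 2 ≤ n) {T₀ : Simplex (clusterComplex n)}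
    (C : GeodesicFiveCycle n) (p : QChain (clusterComplex n) (n - 2) T₀ (C.node 0))
    {a b c d e : ℕ} (h : Pent C.core a b c d e) {δ : Fin 5 → Diagonal n}
    (hδ : PentDiag δ a b c d e) :
    flipCount hn T₀ (C.classVia p) = pentVector δ ∨
      flipCount hn T₀ (C.classVia p) = - pentVector δ := by
  have hinj := hδ.injective h.ab.1 h.bc.1 h.cd.1 h.de.1
  -- `s i` is the position of node `i` in the standard pentagon of triangulations.
  choose s hs using fun i => h.exists_eq_insert hδ C.core_noncrossing C.card_core
    (T := C.tri i) (C.core_subset i)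
  have sinj : Function.Injective s := fun i j hij =>
    C.tri_injective (Subtype.ext (Subtype.ext ((hs i).trans (hij ▸ (hs j).symm))))
  have hmem : ∀ {i k}, δ k ∈ (C.tri i).1.1 → k = s i ∨ k = s i + 1 := by
    intro i k hk
    rw [hs] at hk
    simp only [Finset.mem_insert] at hk
    rcases hk with hk | hk | hk
    exacts [.inl (hinj hk), .inr (hinj hk), absurd hk (h.notMem hδ k)]
  have hadj : ∀ i, s (i + 1) = s i + 1 ∨ s i = s (i + 1) + 1 := by
    intro i
    have hne : s i ≠ s (i + 1) := fun hh => by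
      have : ∀ i : Fin 5, i ≠ i + 1 := by decide
      exact this i (sinj hh)
    have hk : s i = s (i + 1) ∨ s i = s (i + 1) + 1 ∨ s i + 1 = s (i + 1) ∨
        s i + 1 = s (i + 1) + 1 := by
      by_cases h1 : δ (s i) ∈ (C.tri (i + 1)).1.1
      · rcases hmem h1 with h2 | h2
        exacts [.inl h2, .inr (.inl h2)]
      · have h2 : δ (s i + 1) ∈ (C.tri (i + 1)).1.1 := by
          refine erase_subset_of_near (T := C.tri i) (u := δ (s i)) hn (C.near i)
            (by rw [hs]; simp) h1 (Finset.mem_erase.2 ⟨fun hh => ?_, by rw [hs]; simp⟩)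
          have : ∀ i : Fin 5, i + 1 ≠ i := by decide
          exact this _ (hinj hh)
        exact .inr (.inr (hmem h2))
    rcases hk with h1 | h1 | h1 | h1
    exacts [absurd h1 hne, .inr h1, .inl h1.symm, absurd (add_right_cancel h1) hne]
  have sbij : Function.Bijective s := Finite.injective_iff_bijective.1 sinj
  -- For the reversed direction: the step from node `i` to node `i + 1` is the standard step with
  -- index `s (i + 1)` run backwards.
  have s'bij : Function.Bijective fun i => s (i + 1) :=
    sbij.comp (Equiv.addRight (1 : Fin 5)).bijective
  rw [flipCount_classVia]
  rcases fin_five_direction sinj hadj with hdir | hdir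
  · left
    funext q
    rw [pentVector]
    refine Eq.trans ?_ (sbij.sum_comp _)
    exact Finset.sum_congr rfl fun i _ => by rw [quadSign_eq (hs i) (hs (i + 1)), hdir]
  · right
    funext q
    rw [Pi.neg_apply, pentVector]
    refine Eq.trans ?_ (congrArg Neg.neg (s'bij.sum_comp _))
    rw [← Finset.sum_neg_distrib]
    refine Finset.sum_congr rfl fun i _ => ?_
    have e := quadSign_eq (hs (i + 1)) (hs i) q
    rw [hdir i] at e
    rw [quadSign_swap, e]

theorem pairInd_ne_zero {δ : Fin 5 → Diagonal n} {b c d e : ℕ} (hδ : PentDiag δ 0 b c d e)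
    {k : Fin 5} {i j : ℕ} (h : pairInd δ k i j ≠ 0) (hi : 0 < i) :
    (i = b ∧ j = d) ∨ (i = b ∧ j = e) ∨ (i = c ∧ j = e) := by
  have h' : ∃ k, (δ k).1.1.val = i ∧ (δ k).1.2.val = j := by
    unfold pairInd at h
    split_ifs at h with h1
    · exact h1.elim (fun h => ⟨_, h⟩) fun h => ⟨_, h⟩
    · exact absurd rfl h
  obtain ⟨k, hk⟩ := h'
  obtain ⟨l0, r0, l1, r1, l2, r2, l3, r3, l4, r4⟩ := hδ
  revert hk
  revert k
  simp only [forall_fin_five, l0, r0, l1, r1, l2, r2, l3, r3, l4, r4]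
  omega

/-- The signed flip numbers of the pentagon `0bcde`. -/
theorem pentVector_eq {δ : Fin 5 → Diagonal n} {q₀ : Quad n}
    (hδ : PentDiag δ 0 q₀.1.1.val q₀.1.2.1.val q₀.1.2.2.1.val q₀.1.2.2.2.val) :
    pentVector δ = - Pi.single q₀ 1 := by
  funext q
  rw [Pi.neg_apply]
  by_cases hq : q = q₀
  · subst hq
    rw [Pi.single_eq_same]
    obtain ⟨h0, h1, h2, h3⟩ := q.2
    obtain ⟨l0, r0, l1, r1, l2, r2, l3, r3, l4, r4⟩ := hδ
    have n1 := h0.ne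
    have n2 := h1.ne
    have n3 := h2.ne
    have n4 := h3.ne
    simp only [pentVector, pairInd, Fin.sum_univ_five, show (0 : Fin 5) + 1 = 1 from rfl,
      show (1 : Fin 5) + 1 = 2 from rfl, show (2 : Fin 5) + 1 = 3 from rfl,
      show (3 : Fin 5) + 1 = 4 from rfl, show (4 : Fin 5) + 1 = 0 from rfl,
      l0, r0, l1, r1, l2, r2, l3, r3, l4, r4]
    simp [n1, n2, n3, n4, (h0.trans h1).ne, n2.symm, n4.symm]
  · rw [Pi.single_eq_of_ne hq, neg_zero, pentVector]
    refine Finset.sum_eq_zero fun k _ => ?_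
    obtain ⟨h0, h1, h2, h3⟩ := q.2
    obtain ⟨k0, k1, k2, k3⟩ := q₀.2
    -- Only three diagonals of the pentagon avoid `0`, and only two of these cross each other; they
    -- are the diagonals of `q₀`.
    have key : ∀ {k l}, pairInd δ k q.1.2.1.val q.1.2.2.2.val *
        pairInd δ l q.1.1.val q.1.2.2.1.val = 0 := by
      intro k l
      by_contra hc
      have e1 := pairInd_ne_zero hδ (left_ne_zero_of_mul hc) (by omega)
      have e2 := pairInd_ne_zero hδ (right_ne_zero_of_mul hc) h0
      refine hq (Subtype.ext ?_)
      ext <;> omega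
    rw [key, mul_comm, key, sub_zero]

end

/-! ### Labels containing the first vertex, and the basis. -/

section

variable {n : ℕ}

namespace Quad

/-- The label that consists of the vertex `0` and the vertices of a quadrilateral. -/
def label (q : Quad n) : LabelAtFirst n :=
  ⟨{0, q.1.1, q.1.2.1, q.1.2.2.1, q.1.2.2.2},
    card_of_lt (Fin.lt_def.2 q.2.1) q.2.2.1 q.2.2.2.1 q.2.2.2.2, Finset.mem_insert_self _ _⟩

theorem label_bijective : Function.Bijective (label (n := n)) := by
  constructor
  · rintro ⟨⟨b, c, d, e⟩, h0, h1, h2, h3⟩ ⟨⟨b', c', d', e'⟩, h0', h1', h2', h3'⟩ h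
    obtain ⟨-, rfl, rfl, rfl, rfl⟩ := sorted_unique (Fin.lt_def.2 h0) h1 h2 h3 (Fin.lt_def.2 h0')
      h1' h2' h3' (congrArg Subtype.val h)
    rfl
  · rintro ⟨L, hL, h0⟩
    obtain ⟨a, b, c, d, e, hab, hbc, hcd, hde, rfl⟩ := exists_sorted hL
    have ha : a = 0 := by
      simp only [Finset.mem_insert, Finset.mem_singleton, Fin.ext_iff, Fin.val_zero] at h0 ⊢
      simp only [Fin.lt_def] at *
      omega
    subst ha
    exact ⟨⟨(b, c, d, e), hab, hbc, hcd, hde⟩, rfl⟩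

/-- Quadrilaterals that avoid the vertex `0` correspond to labels that contain it. -/
noncomputable def labelEquiv : Quad n ≃ LabelAtFirst n := Equiv.ofBijective label label_bijective

end Quad

theorem card_labelAtFirst : Fintype.card (LabelAtFirst n) = (n + 2).choose 4 := by
  classical
  have h : (Finset.powersetCard 4 ((Finset.univ : Finset (Fin (n + 3))).erase 0)).card =
      (n + 2).choose 4 := by
    rw [Finset.card_powersetCard, Finset.card_erase_of_mem (Finset.mem_univ _), Finset.card_univ,
      Fintype.card_fin]
    rfl
  rw [← h, Fintype.card_subtype]
  refine Finset.card_bij' (fun L _ => L.erase 0) (fun L _ => insert 0 L) ?_ ?_ ?_ ?_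
  · intro L hL
    rw [Finset.mem_filter] at hL
    rw [Finset.mem_powersetCard, Finset.card_erase_of_mem hL.2.2, hL.2.1]
    exact ⟨Finset.erase_subset_erase _ (Finset.subset_univ _), rfl⟩
  · intro L hL
    rw [Finset.mem_powersetCard] at hL
    have h0 : (0 : Fin (n + 3)) ∉ L := fun h0 => Finset.notMem_erase _ _ (hL.1 h0)
    rw [Finset.mem_filter, Finset.card_insert_of_notMem h0, hL.2]
    exact ⟨Finset.mem_univ _, rfl, Finset.mem_insert_self _ _⟩
  · exact fun L hL => Finset.insert_erase (Finset.mem_filter.1 hL).2.2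
  · intro L hL
    exact Finset.erase_insert fun h0 =>
      Finset.notMem_erase _ _ ((Finset.mem_powersetCard.1 hL).1 h0)

namespace Tri

theorem exists_isFiveCycleClass (hn : 2 ≤ n) (T₀ : Tri n) {L : Finset (Fin (n + 3))}
    (hL : L.card = 5) : ∃ x, IsFiveCycleClass T₀.1 L x := by
  obtain ⟨a, b, c, d, e, hab, hbc, hcd, hde, rfl⟩ := exists_sorted hL
  obtain ⟨C, hC⟩ := exists_cycle (n := n) hab hbc hcd hde (by omega)
  obtain ⟨p⟩ := nonempty_chain hn T₀ (near_refl hn (C.tri 0))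
  exact ⟨_, C, isPentagonRegion_iff.2 ⟨a, b, c, d, e, hab, hbc, hcd, hde, rfl, hC⟩, p, rfl⟩

theorem flipCount_class (hn : 2 ≤ n) {T₀ : Tri n} {a b c d e : Fin (n + 3)} (hab : a < b)
    (hbc : b < c) (hcd : c < d) (hde : d < e) {x : ClusterGroupAb n T₀.1}
    (hx : IsFiveCycleClass T₀.1 {a, b, c, d, e} x) {δ : Fin 5 → Diagonal n}
    (hδ : PentDiag δ a b c d e) :
    flipCount hn T₀.1 x = pentVector δ ∨ flipCount hn T₀.1 x = - pentVector δ := by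
  obtain ⟨C, hC, p, rfl⟩ := hx
  obtain ⟨a', b', c', d', e', h1, h2, h3, h4, hL, hP⟩ := isPentagonRegion_iff.1 hC
  obtain ⟨rfl, rfl, rfl, rfl, rfl⟩ := sorted_unique hab hbc hcd hde h1 h2 h3 h4 hL
  exact flipCount_eq_or hn C p hP hδ

/-- Both flip counts are the vector of the pentagon up to sign, and `flipCount` is injective. -/
theorem eq_or_eq_neg_of_isFiveCycleClass (hn : 2 ≤ n) {T₀ : Tri n} {L : Finset (Fin (n + 3))}
    {x y : ClusterGroupAb n T₀.1} (hx : IsFiveCycleClass T₀.1 L x)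
    (hy : IsFiveCycleClass T₀.1 L y) : x = y ∨ x = -y := by
  have hL : L.card = 5 := hx.elim fun C hC => C.card_label hC.1
  obtain ⟨a, b, c, d, e, hab, hbc, hcd, hde, rfl⟩ := exists_sorted hL
  obtain ⟨δ, hδ⟩ := exists_pentDiag (n := n) hab hbc hcd hde (by omega)
  have hinj := flipCount_injective hn T₀
  rcases flipCount_class hn hab hbc hcd hde hx hδ with h1 | h1 <;>
    rcases flipCount_class hn hab hbc hcd hde hy hδ with h2 | h2
  · exact .inl (hinj (h1.trans h2.symm))
  · exact .inr (hinj (by rw [h1, map_neg, h2, neg_neg]))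
  · exact .inr (hinj (by rw [h1, map_neg, h2]))
  · exact .inl (hinj (h1.trans h2.symm))

theorem flipCount_class_label (hn : 2 ≤ n) {T₀ : Tri n} {q : Quad n} {x : ClusterGroupAb n T₀.1}
    (hx : IsFiveCycleClass T₀.1 q.label.1 x) :
    ∃ w : ℤˣ, flipCount hn T₀.1 x = w • Pi.single q 1 := by
  obtain ⟨δ, hδ⟩ := exists_pentDiag (n := n) q.2.1 q.2.2.1 q.2.2.2.1 q.2.2.2.2 (by omega)
  have h := flipCount_class hn (a := 0) (Fin.lt_def.2 q.2.1) q.2.2.1 q.2.2.2.1 q.2.2.2.2 hx hδ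
  rw [pentVector_eq hδ, neg_neg] at h
  rcases h with h | h
  · exact ⟨-1, by rw [h, Units.neg_smul, one_smul]⟩
  · exact ⟨1, by rw [h, one_smul]⟩

theorem flipCount_surjective (hn : 2 ≤ n) (T₀ : Tri n) :
    Function.Surjective (flipCount hn T₀.1) := by
  have key : ∀ q : Quad n, ∃ x, flipCount hn T₀.1 x = Pi.single q 1 := by
    intro q
    obtain ⟨x, hx⟩ := exists_isFiveCycleClass hn T₀ q.label.2.1
    obtain ⟨w, hw⟩ := flipCount_class_label hn hx
    rcases Int.units_eq_one_or w with rfl | rfl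
    · exact ⟨x, by rw [hw, one_smul]⟩
    · exact ⟨-x, by rw [map_neg, hw, Units.neg_smul, one_smul, neg_neg]⟩
  choose x hx using key
  intro v
  refine ⟨∑ q, v q • x q, ?_⟩
  rw [map_sum]
  simp only [map_zsmul, hx]
  funext q
  simp [Finset.sum_apply, Pi.single_apply]

/-- Counting signed flips identifies the group with a free abelian group. -/
noncomputable def flipCountEquiv (hn : 2 ≤ n) (T₀ : Tri n) :
    ClusterGroupAb n T₀.1 ≃ₗ[ℤ] (Quad n → ℤ) :=
  LinearEquiv.ofBijective (flipCount hn T₀.1).toIntLinearMap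
    ⟨flipCount_injective hn T₀, flipCount_surjective hn T₀⟩

/-- Under `flipCountEquiv` the chosen classes are the standard basis vectors multiplied by units,
indexed through `Quad.labelEquiv`. -/
theorem exists_basis (hn : 2 ≤ n) {T₀ : Tri n} {c : LabelAtFirst n → ClusterGroupAb n T₀.1}
    (hc : ∀ L, IsFiveCycleClass T₀.1 L.1 (c L)) :
    ∃ B : Module.Basis (LabelAtFirst n) ℤ (ClusterGroupAb n T₀.1), ⇑B = c := by
  choose w hw using fun q : Quad n => flipCount_class_label hn (hc q.label)
  refine ⟨((((Pi.basisFun ℤ (Quad n)).unitsSMul w).map (flipCountEquiv hn T₀).symm).reindex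
    Quad.labelEquiv), ?_⟩
  funext L
  obtain ⟨q, rfl⟩ := Quad.labelEquiv.surjective L
  rw [Module.Basis.reindex_apply, Equiv.symm_apply_apply, Module.Basis.map_apply,
    LinearEquiv.symm_apply_eq, Module.Basis.unitsSMul_apply, Pi.basisFun_apply]
  exact (hw q).symm

end Tri

end

theorem theorem1p2 (n : ℕ) (hn : 2 ≤ n) (T₀ : Simplex (clusterComplex n))
    (hT₀ : IsMaximalSimplex T₀) :
    -- the group is free abelian
    Module.Free ℤ (ClusterGroupAb n T₀) ∧
    -- every geodesic 5-cycle has exactly one label, and labels have five elements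
    (∀ C : GeodesicFiveCycle n, ∃! L : Finset (Fin (n + 3)), C.HasLabel L) ∧
    (∀ (C : GeodesicFiveCycle n) (L : Finset (Fin (n + 3))), C.HasLabel L → L.card = 5) ∧
    -- every geodesic 5-cycle can be reached from the base simplex, and its class does not depend on
    -- the connecting path
    (∀ C : GeodesicFiveCycle n,
      Nonempty (QChain (clusterComplex n) (n - 2) T₀ (C.node 0)) ∧
      ∀ p p' : QChain (clusterComplex n) (n - 2) T₀ (C.node 0), C.classVia p = C.classVia p') ∧
    -- every five-element set of vertices is the label of a geodesic 5-cycle, and its label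
    -- determines the class up to the direction in which the cycle is traversed
    (∀ L : Finset (Fin (n + 3)), L.card = 5 → ∃ x, IsFiveCycleClass T₀ L x) ∧
    (∀ (L : Finset (Fin (n + 3))) (x y : ClusterGroupAb n T₀),
      IsFiveCycleClass T₀ L x → IsFiveCycleClass T₀ L y → x = y ∨ x = -y) ∧
    -- the classes of the cycles whose label contains the first vertex (one for each label, with any
    -- choice of direction) are a basis, with `(n + 2).choose 4` elements
    (∀ c : LabelAtFirst n → ClusterGroupAb n T₀, (∀ L, IsFiveCycleClass T₀ L.1 (c L)) →
      LinearIndependent ℤ c ∧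
      AddSubgroup.closure (Set.range c) = ⊤ ∧
      (Set.range c).encard = ((n + 2).choose 4 : ℕ) ∧
      ∀ S : Set (ClusterGroupAb n T₀), S ⊂ Set.range c → AddSubgroup.closure S ≠ ⊤) ∧
    -- and no generating set has fewer elements
    (∀ S : Set (ClusterGroupAb n T₀), AddSubgroup.closure S = ⊤ →
      (((n + 2).choose 4 : ℕ) : ℕ∞) ≤ S.encard) := by
  classical
  let T : Tri n := ⟨T₀, hT₀⟩
  have hex : ∃ c : LabelAtFirst n → ClusterGroupAb n T₀, ∀ L, IsFiveCycleClass T₀ L.1 (c L) :=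
    ⟨fun L => (T.exists_isFiveCycleClass hn L.2.1).choose,
      fun L => (T.exists_isFiveCycleClass hn L.2.1).choose_spec⟩
  have hspan : ∀ S : Set (ClusterGroupAb n T₀), AddSubgroup.closure S = ⊤ →
      Submodule.span ℤ S = ⊤ := by
    intro S hS
    rw [← Submodule.toAddSubgroup_inj, Submodule.span_int_eq_addSubgroupClosure, hS]
    rfl
  refine ⟨Module.Free.of_equiv (T.flipCountEquiv hn).symm, fun C => C.existsUnique_label,
    fun C L h => C.card_label h, fun C => ⟨T.nonempty_chain hn (Tri.near_refl hn (C.tri 0)),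
      fun p p' => ?_⟩, fun L hL => T.exists_isFiveCycleClass hn hL,
    fun L x y hx hy => Tri.eq_or_eq_neg_of_isFiveCycleClass (T₀ := T) hn hx hy, fun c hc => ?_,
    fun S hS => ?_⟩
  · exact T.flipCount_injective hn
      ((Tri.flipCount_classVia hn C p).trans (Tri.flipCount_classVia hn C p').symm)
  · obtain ⟨B, rfl⟩ := Tri.exists_basis (T₀ := T) hn hc
    refine ⟨B.linearIndependent, ?_, ?_, fun S hS hcl => ?_⟩
    · rw [← Submodule.span_int_eq_addSubgroupClosure, B.span_eq]
      rfl
    · rw [← Set.image_univ, B.injective.encard_image, Set.encard_univ,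
        ENat.card_eq_coe_fintype_card, card_labelAtFirst]
    · have hsub := hS.subset
      obtain ⟨x, ⟨L, rfl⟩, hL⟩ := Set.exists_of_ssubset hS
      refine B.linearIndependent.notMem_span_image (s := {L}ᶜ) (x := L) (by simp) ?_
      -- A proper subset misses some basis vector `B L`, which is not in the span of the others.
      have hS' : S ⊆ B '' {L}ᶜ := by
        intro y hy
        obtain ⟨L', rfl⟩ := hsub hy
        exact ⟨L', fun h => hL (h ▸ hy), rfl⟩
      refine Submodule.span_mono hS' ?_
      rw [hspan S hcl]
      trivial
  · obtain ⟨c, hc⟩ := hex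
    obtain ⟨B, -⟩ := Tri.exists_basis (T₀ := T) hn hc
    rcases S.finite_or_infinite with hfin | hinf
    · have := hfin.fintype
      have h1 := finrank_span_le_card (R := ℤ) S
      rw [hspan S hS, finrank_top, Module.finrank_eq_card_basis B, card_labelAtFirst] at h1
      rw [Set.encard_eq_coe_toFinset_card]
      exact_mod_cast h1
    · rw [hinf.encard_eq]
      exact le_top
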